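/- Let $\mathbb T^1=\mathbb R/\mathbb Z$ and let $p_1:\mathbb T^2\to\mathbb T^1$ be the projection to the first coordinate. A quasiperiodically forced (qpf) circle homeomorphism over the rotation by $\omega\in\mathbb R\setminus\mathbb Q$ is a homeomorphism $R$ of $\mathbb T^2$, isotopic to the identity, of the form $R(\theta,x)=(\theta+\omega,R_\theta(x))$. For integers $p,q\ge 1$, a continuous $(p,q)$-invariant graph of $R$ is a minimal (non-empty, compact) $R$-invariant set $K\subseteq\mathbb T^2$ such that $p_1|_K:K\to\mathbb T^1$ is a $pq$-fold covering and $K$ has exactly $p$ connected components. A continuous graph is the graph $\Gamma\subset\mathbb T^2$ of a continuous map $\gamma:\mathbb T^1\to\mathbb T^1$. An interval of $\mathbb T^1$ is a non-empty connected subset (the whole circle is allowed), and it is non-trivial if it has more than one point. For $I\subseteq\mathbb T^1$ write $\Gamma_{|I}=\Gamma\cap(I\times\mathbb T^1)$. Two graphs $\Gamma,\Gamma'$ have flat intersections if $p_1(\Gamma\cap\Gamma')$ is a finite (possibly empty) union of pairwise disjoint intervals, none of which is reduced to a single point. They cross over a set $A\subseteq\mathbb T^1$ if there are an interval $I'\subseteq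 A$ and an open interval $O\subsetneq\mathbb T^1$ such that $\Gamma_{|I'},\Gamma'_{|I'}\subset I'\times O$ and $\Gamma'_{|I'}$ meets both connected components of $(I'\times O)\setminus\Gamma$. Let $R$ be a qpf circle homeomorphism over the rotation by $\omega$ that admits no continuous $(p,q)$-invariant graph, for any $p,q\ge1$. Then there exists a continuous graph $\Gamma$ that has flat intersections with all its iterates $R^n(\Gamma)$, $n\in\mathbb Z$. If moreover $R$ is topologically transitive (for all non-empty open $U,V\subseteq\mathbb T^2$ there is $n\ge0$ with $R^n(U)\cap V\neq\emptyset$), then $\Gamma$ can be chosen to have flat intersections with all its iterates $R^n(\Gamma)$, $n\in\mathbb Z$, and to satisfy in addition: for all non-trivial intervals $I,J\subset\mathbb T^1$ there exists $n\ge 0$ such that $\Gamma$ and $R^n(\Gamma)$ cross over $I\cap(J+n\omega)$. -/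

import Mathlib

namespace QPF

/-- The circle `𝕋 = ℝ / ℤ`. -/
abbrev Circ : Type := AddCircle (1 : ℝ)

/-- The two-torus. -/
abbrev Torus : Type := Circ × Circ

/-- `f` is isotopic to the identity: it is joined to the identity by a continuous path of
homeomorphisms of the torus. -/
def IsotopicToId (f : Torus ≃ₜ Torus) : Prop :=
  ∃ H : unitInterval → (Torus ≃ₜ Torus),
    Continuous (fun z : unitInterval × Torus => H z.1 z.2) ∧
      H 0 = Homeomorph.refl Torus ∧ H 1 = f

/-- Quasiperiodically forced circle homeomorphisms over the rotation by the irrational number `ω`: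
homeomorphisms of the torus, isotopic to the identity, of the form
`(θ, x) ↦ (θ + ω, f_θ(x))`. -/
structure IsQPFHomeo (ω : ℝ) (f : Torus ≃ₜ Torus) : Prop where
  irrational : Irrational ω
  isotopic : IsotopicToId f
  skew : ∀ z : Torus, (f z).1 = z.1 + (ω : Circ)

/-- `K` is a minimal invariant set of `f`: a non-empty compact invariant set without non-empty
compact invariant proper subsets. -/
structure IsMinimalSet (f : Torus ≃ₜ Torus) (K : Set Torus) : Prop where
  compact : IsCompact K
  nonempty : K.Nonempty
  invariant : f '' K = K
  minimal : ∀ L : Set Torus, L ⊆ K → IsCompact L → L.Nonempty → f '' L = L → L = K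

/-- Continuous `(p, q)`-invariant graphs, `p, q ≥ 1`: minimal invariant sets `K` on which the
projection to the first coordinate is a `pq`-fold covering of the circle, and which have `p`
connected components. -/
structure IsContinuousInvariantGraph (f : Torus ≃ₜ Torus) (p q : ℕ) (K : Set Torus) : Prop where
  one_le_p : 1 ≤ p
  one_le_q : 1 ≤ q
  minimalSet : IsMinimalSet f K
  covering : IsCoveringMap (fun z : K => (z : Torus).1)
  fibre_card : ∀ θ : Circ, Nat.card {z : K // (z : Torus).1 = θ} = p * q
  components_card : Nat.card (ConnectedComponents K) = p

/-- The graph of a map of the circle, as a subset of the torus. -/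
def graph (γ : Circ → Circ) : Set Torus := {z | z.2 = γ z.1}

/-- The part `Γ ∩ (I × 𝕋)` of `Γ` over `I`. -/
def above (Γ : Set Torus) (I : Set Circ) : Set Torus := Γ ∩ I ×ˢ Set.univ

/-- Intervals of the circle are its non-empty connected subsets (the whole circle included). -/
def IsInterval (I : Set Circ) : Prop := IsConnected I

/-- Intervals with more than one point. -/
def IsNontrivialInterval (I : Set Circ) : Prop := IsInterval I ∧ I.Nontrivial

/-- `Γ` and `Γ'` have flat intersections: `p₁(Γ ∩ Γ')` is a finite (possibly empty) union of
pairwise disjoint intervals, none of which is reduced to a point. -/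
def FlatIntersections (Γ Γ' : Set Torus) : Prop :=
  ∃ S : Set (Set Circ), S.Finite ∧ (∀ I ∈ S, IsNontrivialInterval I) ∧
    S.PairwiseDisjoint id ∧ Prod.fst '' (Γ ∩ Γ') = ⋃₀ S

/-- `Γ` and `Γ'` cross over `A`. For a continuous graph `Γ` with `Γ_{|I} ⊆ I × O`, where `I` is an
interval and `O` is an open interval other than the circle, `(I × O) \ Γ` has exactly two connected
components; the last clause says that `Γ'_{|I}` meets each of them. -/
def CrossOver (Γ Γ' : Set Torus) (A : Set Circ) : Prop :=
  ∃ I O : Set Circ, I ⊆ A ∧ IsInterval I ∧ IsOpen O ∧ IsInterval O ∧ O ≠ Set.univ ∧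
    above Γ I ⊆ I ×ˢ O ∧ above Γ' I ⊆ I ×ˢ O ∧
    ∀ z ∈ (I ×ˢ O) \ Γ, (above Γ' I ∩ connectedComponentIn ((I ×ˢ O) \ Γ) z).Nonempty

/-- The `n`-th iterate of the set `Γ`, for `n ∈ ℤ`. -/
def iter (f : Torus ≃ₜ Torus) (n : ℤ) (Γ : Set Torus) : Set Torus := (f ^ n) '' Γ

/-- Topological transitivity. -/
def IsTransitive (f : Torus ≃ₜ Torus) : Prop :=
  ∀ U V : Set Torus, IsOpen U → IsOpen V → U.Nonempty → V.Nonempty →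
    ∃ n : ℕ, (f^[n] '' U ∩ V).Nonempty

/-- The set `J + nω`. -/
def translate (ω : ℝ) (n : ℤ) (J : Set Circ) : Set Circ :=
  (fun θ : Circ => θ + n • (ω : Circ)) '' J

end QPF

/-! Pulling the part of the graph over `θ + kα` back to the fibre over `θ` gives the curves `coord
k`. Flat intersections then become a condition on the closed sets `coincidence 0 n`: each must be
flat at each of its points, and compactness turns this into finitely many non-trivial intervals
(`exists_intervals_of_flatAt`).

The graph is a limit of successive small perturbations. A closed neighbourhood `V` of `0` cuts the
orbits of the rotation into segments of bounded length. Translating the fibre coordinate by the same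
amount `τ` along a whole uncut segment preserves every coincidence inside that segment
(`IsBox.coherent_perturb`), so flatness obtained earlier is never destroyed. When `V` is shrunk, the
new pairs of times to control are separated by the old `V` and have bounded difference. They are
made flat arc by arc, by choosing `τ` to meet finitely many given curves in flat sets
(`exists_flat_perturbation`, `exists_flat_of_distinctOn`). The endpoints of the arcs lie on the
orbit of `0`, where values at separated times are kept distinct.

In the limit (`exists_limit_graph`), fix `θ` and `n`. If some `V` does not cut the orbit segment of
`θ` between the times `0` and `n`, the coincidence set near `θ` is frozen from that stage on.
Otherwise the segment passes through `0`, and there is no coincidence at `θ`.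

Crossing over prescribed open sets is an open condition on the graph, and under transitivity it can
be reached by arbitrarily small coherent perturbations (`IsTransitive.exists_crosses`). Countably
many crossings, one for each pair of basic open sets, can thus be imposed during the same
construction. -/

namespace QPF

open Filter Topology Set

section

/-! ### The circle -/

theorem exists_lift_abs_eq_norm (x : Circ) : ∃ t : ℝ, (t : Circ) = x ∧ |t| = ‖x‖ := by
  obtain ⟨y, rfl⟩ := QuotientAddGroup.mk_surjective x
  refine ⟨y - round y, ?_, (UnitAddCircle.norm_eq (x := y)).symm⟩
  have : ((round y : ℝ) : Circ) = 0 :=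
    (AddCircle.coe_eq_zero_iff (1 : ℝ)).2 ⟨round y, by simp⟩
  change ((y - round y : ℝ) : Circ) = (y : Circ)
  rw [AddCircle.coe_sub, this, sub_zero]

theorem norm_coe_le_abs (t : ℝ) : ‖(t : Circ)‖ ≤ |t| := by
  rw [UnitAddCircle.norm_eq]
  simpa using round_le t 0

theorem norm_coe_eq_abs {t : ℝ} (h : |t| ≤ 1 / 2) : ‖(t : Circ)‖ = |t| :=
  (AddCircle.norm_coe_eq_abs_iff (1 : ℝ) one_ne_zero).2 (by simpa using h)

theorem coe_ne_zero_of_abs_lt_one {t : ℝ} (h0 : t ≠ 0) (h1 : |t| < 1) : (t : Circ) ≠ 0 := by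
  intro h
  obtain ⟨n, hn⟩ := (AddCircle.coe_eq_zero_iff (1 : ℝ)).1 h
  simp only [zsmul_eq_mul, mul_one] at hn
  rw [← hn] at h0 h1
  rw [← Int.cast_abs] at h1
  have h2 : |n| < 1 := by exact_mod_cast h1
  exact h0 (by simpa using Int.abs_lt_one_iff.1 h2)

theorem continuous_coe : Continuous ((↑) : ℝ → Circ) := AddCircle.continuous_mk' 1

theorem isOpenMap_coe : IsOpenMap ((↑) : ℝ → Circ) := QuotientAddGroup.isOpenMap_coe

/-- A continuous real coordinate on the circle, which inverts the projection near zero. -/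
noncomputable def signedNorm (x : Circ) : ℝ := ‖x + ((1 / 4 : ℝ) : Circ)‖ - 1 / 4

theorem continuous_signedNorm : Continuous signedNorm := by
  unfold signedNorm
  fun_prop

theorem abs_signedNorm_le (x : Circ) : |signedNorm x| ≤ ‖x‖ := by
  have h : ‖((1 / 4 : ℝ) : Circ)‖ = 1 / 4 := by
    rw [norm_coe_eq_abs (by norm_num [abs_of_pos])]
    norm_num
  have := abs_norm_sub_norm_le (x + ((1 / 4 : ℝ) : Circ)) ((1 / 4 : ℝ) : Circ)
  rwa [h, add_sub_cancel_right] at this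

/-- The shift by `1/4` moves the argument into `[0, 1/2]`, where the norm is the identity. -/
theorem signedNorm_coe {t : ℝ} (h : |t| ≤ 1 / 4) : signedNorm (t : Circ) = t := by
  obtain ⟨h1, h2⟩ := abs_le.1 h
  unfold signedNorm
  rw [← AddCircle.coe_add, norm_coe_eq_abs (by rw [abs_le]; constructor <;> linarith),
    abs_of_nonneg (by linarith)]
  ring

theorem coe_signedNorm {x : Circ} (h : ‖x‖ ≤ 1 / 4) : (signedNorm x : Circ) = x := by
  obtain ⟨t, rfl, ht⟩ := exists_lift_abs_eq_norm x
  rw [signedNorm_coe (by rw [ht]; exact h)]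

/-! ### Locally flat sets -/

/-- A set of reals is flat at a point if it does not contain it, or coincides near it with
a neighbourhood or a one-sided neighbourhood. -/
def FlatAtReal (A : Set ℝ) (t : ℝ) : Prop :=
  t ∈ A → (∀ᶠ s in 𝓝 t, s ∈ A) ∨ (∀ᶠ s in 𝓝 t, (s ∈ A ↔ t ≤ s)) ∨ (∀ᶠ s in 𝓝 t, (s ∈ A ↔ s ≤ t))

/-- Flatness of a subset of the circle at a point. -/
def FlatAt (A : Set Circ) (θ : Circ) : Prop :=
  θ ∈ A → (∀ᶠ s : ℝ in 𝓝 0, θ + (s : Circ) ∈ A) ∨ (∀ᶠ s : ℝ in 𝓝 0, (θ + (s : Circ) ∈ A ↔ 0 ≤ s)) ∨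
    (∀ᶠ s : ℝ in 𝓝 0, (θ + (s : Circ) ∈ A ↔ s ≤ 0))

theorem FlatAtReal.congr {A B : Set ℝ} {t : ℝ} (h : ∀ᶠ s in 𝓝 t, (s ∈ A ↔ s ∈ B))
    (hA : FlatAtReal A t) : FlatAtReal B t := by
  intro ht
  rcases hA (h.self_of_nhds.2 ht) with h1 | h1 | h1
  · exact Or.inl (by filter_upwards [h, h1] with s hs h1s using hs.1 h1s)
  · exact Or.inr (Or.inl (by filter_upwards [h, h1] with s hs h1s using hs.symm.trans h1s))
  · exact Or.inr (Or.inr (by filter_upwards [h, h1] with s hs h1s using hs.symm.trans h1s))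

theorem tendsto_add_coe (θ : Circ) : Tendsto (fun s : ℝ => θ + (s : Circ)) (𝓝 0) (𝓝 θ) := by
  have : Continuous (fun s : ℝ => θ + (s : Circ)) := continuous_const.add continuous_coe
  simpa using this.tendsto 0

theorem FlatAt.congr {A B : Set Circ} {θ : Circ} (h : ∀ᶠ s in 𝓝 θ, (s ∈ A ↔ s ∈ B))
    (hA : FlatAt A θ) : FlatAt B θ := by
  intro ht
  have h' := (tendsto_add_coe θ).eventually h
  rcases hA (h.self_of_nhds.2 ht) with h1 | h1 | h1
  · exact Or.inl (by filter_upwards [h', h1] with s hs h1s using hs.1 h1s)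
  · exact Or.inr (Or.inl (by filter_upwards [h', h1] with s hs h1s using hs.symm.trans h1s))
  · exact Or.inr (Or.inr (by filter_upwards [h', h1] with s hs h1s using hs.symm.trans h1s))

theorem FlatAt.translate {A B : Set Circ} {θ β : Circ} (h : ∀ x, x ∈ B ↔ x + β ∈ A)
    (hA : FlatAt A (θ + β)) : FlatAt B θ := by
  intro ht
  have key : ∀ s : ℝ, (θ + s ∈ B ↔ θ + β + s ∈ A) := fun s => by
    rw [h, add_right_comm]
  simp only [key]
  exact hA ((h θ).1 ht)

theorem FlatAt.of_real {A : Set Circ} {t : ℝ} (h : FlatAtReal {s : ℝ | (s : Circ) ∈ A} t) :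
    FlatAt A (t : Circ) := by
  intro ht
  have h0 : Tendsto (fun s : ℝ => t + s) (𝓝 0) (𝓝 t) := by
    have : Continuous (fun s : ℝ => t + s) := by fun_prop
    simpa using this.tendsto 0
  rcases h ht with h1 | h1 | h1
  · refine Or.inl ?_
    filter_upwards [h0.eventually h1] with s hs
    simpa using hs
  · refine Or.inr (Or.inl ?_)
    filter_upwards [h0.eventually h1] with s hs
    simpa using hs
  · refine Or.inr (Or.inr ?_)
    filter_upwards [h0.eventually h1] with s hs
    simpa using hs

theorem FlatAtReal.of_notMem {A : Set ℝ} {t : ℝ} (h : t ∉ A) : FlatAtReal A t :=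
  fun h' => absurd h' h

theorem FlatAt.of_notMem {A : Set Circ} {θ : Circ} (h : θ ∉ A) : FlatAt A θ :=
  fun h' => absurd h' h

/-- A flat point of a set has a small arc neighbourhood whose trace on the set is connected. -/
theorem FlatAt.exists_isConnected {A : Set Circ} {θ : Circ} (h : FlatAt A θ) (hθ : θ ∈ A) :
    ∃ C : Set Circ, C ⊆ A ∧ IsConnected C ∧ C.Nontrivial ∧ θ ∈ C ∧ ∀ᶠ x in 𝓝 θ, x ∈ A → x ∈ C := by
  have himg : ∀ {ε : ℝ} {D : Set ℝ}, 0 < ε → (∀ s : ℝ, |s| < ε → θ + (s : Circ) ∈ A → s ∈ D) →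
      ∀ᶠ x in 𝓝 θ, x ∈ A → x ∈ (fun s : ℝ => θ + (s : Circ)) '' D := by
    intro ε D hε hD
    filter_upwards [Metric.ball_mem_nhds θ hε] with x hx hxA
    rw [Metric.mem_ball, dist_eq_norm] at hx
    obtain ⟨t, ht, hta⟩ := exists_lift_abs_eq_norm (x - θ)
    refine ⟨t, hD t (by rw [hta]; exact hx) (by rw [ht]; simpa using hxA), by simp [ht]⟩
  have hcont : Continuous (fun s : ℝ => θ + (s : Circ)) := continuous_const.add continuous_coe
  have hne : ∀ {s : ℝ}, s ≠ 0 → |s| < 1 → θ + (s : Circ) ≠ θ := fun h0 h1 h2 =>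
    coe_ne_zero_of_abs_lt_one h0 h1 (by simpa using h2)
  rcases h hθ with h1 | h1 | h1
  · obtain ⟨ε, hε, h2⟩ := Metric.eventually_nhds_iff.1 h1
    simp only [Real.dist_eq, sub_zero] at h2
    -- The cap at `1` ensures that the point at half the radius does not project to `θ`, so the arc
    -- is non-trivial.
    have hε' : 0 < min ε 1 := by positivity
    refine ⟨(fun s : ℝ => θ + (s : Circ)) '' Ioo (-min ε 1) (min ε 1), ?_,
      (isConnected_Ioo (by linarith)).image _ hcont.continuousOn, ?_, ⟨0, by simp [hε], by simp⟩,
          ?_⟩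
    · rintro _ ⟨s, hs, rfl⟩
      exact h2 ((abs_lt.2 hs).trans_le (min_le_left _ _))
    · refine ⟨_, ⟨0, by simp [hε], rfl⟩, _, ⟨min ε 1 / 2, ⟨by linarith, by linarith⟩, rfl⟩, ?_⟩
      simp only [AddCircle.coe_zero, add_zero]
      refine (hne (by positivity) ?_).symm
      rw [abs_of_pos (by positivity)]
      have := min_le_right ε 1
      linarith
    · exact himg hε' fun s hs _ => abs_lt.1 hs
  · obtain ⟨ε, hε, h2⟩ := Metric.eventually_nhds_iff.1 h1
    simp only [Real.dist_eq, sub_zero] at h2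
    have hε' : 0 < min ε 1 := by positivity
    refine ⟨(fun s : ℝ => θ + (s : Circ)) '' Ico 0 (min ε 1), ?_,
      (isConnected_Ico hε').image _ hcont.continuousOn, ?_, ⟨0, by simp [hε], by simp⟩, ?_⟩
    · rintro _ ⟨s, hs, rfl⟩
      refine (h2 ?_).2 hs.1
      rw [abs_of_nonneg hs.1]
      exact hs.2.trans_le (min_le_left _ _)
    · refine ⟨_, ⟨0, by simp [hε], rfl⟩, _, ⟨min ε 1 / 2, ⟨by linarith, by linarith⟩, rfl⟩, ?_⟩
      simp only [AddCircle.coe_zero, add_zero]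
      refine (hne (by positivity) ?_).symm
      rw [abs_of_pos (by positivity)]
      have := min_le_right ε 1
      linarith
    · exact himg hε' fun s hs hsA =>
        ⟨(h2 (hs.trans_le (min_le_left _ _))).1 hsA, (abs_lt.1 hs).2⟩
  · obtain ⟨ε, hε, h2⟩ := Metric.eventually_nhds_iff.1 h1
    simp only [Real.dist_eq, sub_zero] at h2
    have hε' : 0 < min ε 1 := by positivity
    refine ⟨(fun s : ℝ => θ + (s : Circ)) '' Ioc (-min ε 1) 0, ?_,
      (isConnected_Ioc (by linarith)).image _ hcont.continuousOn, ?_, ⟨0, by simp [hε], by simp⟩,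
          ?_⟩
    · rintro _ ⟨s, hs, rfl⟩
      refine (h2 ?_).2 hs.2
      rw [abs_of_nonpos hs.2]
      have := min_le_left ε 1
      linarith [hs.1]
    · refine ⟨_, ⟨0, by simp [hε], rfl⟩, _, ⟨-(min ε 1 / 2), ⟨by linarith, by linarith⟩, rfl⟩, ?_⟩
      simp only [AddCircle.coe_zero, add_zero]
      refine (hne (by linarith) ?_).symm
      rw [abs_neg, abs_of_pos (by positivity)]
      have := min_le_right ε 1
      linarith
    · exact himg hε' fun s hs hsA =>
        ⟨(abs_lt.1 hs).1, (h2 (hs.trans_le (min_le_left _ _))).1 hsA⟩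

/-- A closed set that is flat at each of its points is a finite union of disjoint non-trivial
intervals. -/
theorem exists_intervals_of_flatAt {A : Set Circ} (hA : IsClosed A) (h : ∀ θ, FlatAt A θ) :
    ∃ S : Set (Set Circ), S.Finite ∧ (∀ I ∈ S, IsNontrivialInterval I) ∧
      S.PairwiseDisjoint id ∧ A = ⋃₀ S := by
  -- Near each of its points `A` has only one component, so by compactness there are finitely many.
  have hC : ∀ θ ∈ A, (connectedComponentIn A θ).Nontrivial ∧
      ∀ᶠ x in 𝓝 θ, x ∈ A → x ∈ connectedComponentIn A θ := by
    intro θ hθ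
    obtain ⟨C, hCA, hCc, hCn, hθC, hev⟩ := (h θ).exists_isConnected hθ
    have hsub := hCc.isPreconnected.subset_connectedComponentIn hθC hCA
    exact ⟨hCn.mono hsub, hev.mono fun x hx hxA => hsub (hx hxA)⟩
  refine ⟨connectedComponentIn A '' A, ?_, ?_, ?_, ?_⟩
  · obtain ⟨t, hcov⟩ := hA.isCompact.elim_nhds_subcover'
      (fun θ _ => {x | x ∈ A → x ∈ connectedComponentIn A θ}) (fun θ hθ => (hC θ hθ).2)
    refine (t.finite_toSet.image fun θ : A => connectedComponentIn A θ).subset ?_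
    rintro _ ⟨x, hx, rfl⟩
    obtain ⟨θ, hθt, hxθ⟩ := mem_iUnion₂.1 (hcov hx)
    exact ⟨θ, hθt, (connectedComponentIn_eq (hxθ hx))⟩
  · rintro _ ⟨θ, hθ, rfl⟩
    exact ⟨isConnected_connectedComponentIn_iff.2 hθ, (hC θ hθ).1⟩
  · rintro _ ⟨x, hx, rfl⟩ _ ⟨y, hy, rfl⟩ hne
    refine Set.disjoint_left.2 fun z hzx hzy => hne ?_
    exact (connectedComponentIn_eq hzx).trans (connectedComponentIn_eq hzy).symm
  · ext x
    constructor
    · intro hx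
      exact ⟨_, ⟨x, hx, rfl⟩, mem_connectedComponentIn hx⟩
    · rintro ⟨_, ⟨y, hy, rfl⟩, hx⟩
      exact connectedComponentIn_subset A y hx

end

section

/-! ### Skew products and coordinates along orbits -/

/-- `R` is a skew product over the rotation by `α`. -/
def IsSkew (R : Torus ≃ₜ Torus) (α : Circ) : Prop := ∀ z, (R z).1 = z.1 + α

theorem IsSkew.zpow_fst {R : Torus ≃ₜ Torus} {α : Circ} (hR : IsSkew R α) (k : ℤ) (z : Torus) :
    ((R ^ k) z).1 = z.1 + k • α := by
  induction k using Int.induction_on generalizing z with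
  | zero => simp
  | succ n ih =>
    rw [zpow_add_one, Homeomorph.mul_apply, ih, hR, add_zsmul, one_zsmul]
    abel
  | pred n ih =>
    have h : ((R⁻¹) z).1 = z.1 - α := by
      have := hR ((R⁻¹) z)
      rw [← Homeomorph.mul_apply, mul_inv_cancel, Homeomorph.one_apply] at this
      rw [this, add_sub_cancel_right]
    rw [zpow_sub_one, Homeomorph.mul_apply, ih, h, sub_zsmul, one_zsmul]
    abel

/-- The fibre coordinate of the `k`-th iterate. -/
def fib (R : Torus ≃ₜ Torus) (k : ℤ) (z : Torus) : Circ := ((R ^ k) z).2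

@[fun_prop]
theorem continuous_fib (R : Torus ≃ₜ Torus) (k : ℤ) : Continuous (fib R k) :=
  continuous_snd.comp (R ^ k).continuous

variable {R : Torus ≃ₜ Torus} {α : Circ}

theorem IsSkew.zpow_apply (hR : IsSkew R α) (k : ℤ) (θ x : Circ) :
    (R ^ k) (θ, x) = (θ + k • α, fib R k (θ, x)) :=
  Prod.ext (hR.zpow_fst k (θ, x)) rfl

theorem IsSkew.fib_add (hR : IsSkew R α) (k l : ℤ) (θ x : Circ) :
    fib R (k + l) (θ, x) = fib R k (θ + l • α, fib R l (θ, x)) := by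
  rw [fib, zpow_add, Homeomorph.mul_apply, hR.zpow_apply l]
  rfl

theorem fib_zero (z : Torus) : fib R 0 z = z.2 := by
  simp [fib]

theorem IsSkew.fib_injective (hR : IsSkew R α) (k : ℤ) (θ : Circ) :
    Function.Injective fun x => fib R k (θ, x) := by
  intro x y h
  have : (R ^ k) (θ, x) = (R ^ k) (θ, y) := by
    rw [hR.zpow_apply, hR.zpow_apply]
    exact Prod.ext rfl h
  exact congrArg Prod.snd ((R ^ k).injective this)

/-- The value of `γ` over `θ + kα`, pulled back to the fibre over `θ`. -/
def coord (R : Torus ≃ₜ Torus) (α : Circ) (γ : C(Circ, Circ)) (k : ℤ) (θ : Circ) : Circ :=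
  fib R (-k) (θ + k • α, γ (θ + k • α))

theorem coord_zero (γ : C(Circ, Circ)) (θ : Circ) : coord R α γ 0 θ = γ θ := by
  simp [coord, fib_zero]

@[fun_prop]
theorem continuous_coord (R : Torus ≃ₜ Torus) (α : Circ) (γ : C(Circ, Circ)) (k : ℤ) :
    Continuous (coord R α γ k) := by
  unfold coord
  fun_prop

/-- `coord` depends continuously on the graph. -/
theorem continuous_coordMap (R : Torus ≃ₜ Torus) (α : Circ) (k : ℤ) :
    Continuous fun γ : C(Circ, Circ) =>
        (⟨coord R α γ k, continuous_coord R α γ k⟩ : C(Circ, Circ)) := by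
  apply ContinuousMap.continuous_of_continuous_uncurry
  simp only [Function.uncurry_def, ContinuousMap.coe_mk, coord]
  fun_prop

theorem continuous_coord_apply (R : Torus ≃ₜ Torus) (α : Circ) (k : ℤ) (θ : Circ) :
    Continuous fun γ : C(Circ, Circ) => coord R α γ k θ := by
  unfold coord
  fun_prop

/-- Cocycle rule: moving the base point applies one injective fibre map to all pulled-back values
and shifts the times. Coincidences are therefore merely reindexed. -/
theorem IsSkew.coord_add (hR : IsSkew R α) (γ : C(Circ, Circ)) (i k : ℤ) (θ : Circ) :
    coord R α γ i (θ + k • α) = fib R k (θ, coord R α γ (i + k) θ) := by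
  unfold coord
  have h : -i = k + -(i + k) := by ring
  have h1 : θ + k • α + i • α = θ + (i + k) • α := by rw [add_zsmul]; abel
  have h2 : θ + (i + k) • α + (-(i + k)) • α = θ := by rw [neg_zsmul, add_neg_cancel_right]
  rw [h1, h, hR.fib_add, h2]

theorem IsSkew.apply_eq_fib_coord (hR : IsSkew R α) (γ : C(Circ, Circ)) (k : ℤ) (θ : Circ) :
    γ (θ + k • α) = fib R k (θ, coord R α γ k θ) := by
  rw [← coord_zero (R := R) (α := α), hR.coord_add, zero_add]

theorem IsSkew.coord_eq_iff_apply (hR : IsSkew R α) {γ : C(Circ, Circ)} {k : ℤ} {θ x : Circ} :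
    coord R α γ k θ = x ↔ γ (θ + k • α) = fib R k (θ, x) := by
  rw [hR.apply_eq_fib_coord]
  exact ((hR.fib_injective k θ).eq_iff (a := coord R α γ k θ) (b := x)).symm

/-- The set of points over which the graph `γ` meets itself at times `i` and `j`. -/
def coincidence (R : Torus ≃ₜ Torus) (α : Circ) (γ : C(Circ, Circ)) (i j : ℤ) : Set Circ :=
  {θ | coord R α γ i θ = coord R α γ j θ}

theorem isClosed_coincidence (γ : C(Circ, Circ)) (i j : ℤ) :
    IsClosed (coincidence R α γ i j) :=
  isClosed_eq (continuous_coord R α γ i) (continuous_coord R α γ j)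

theorem IsSkew.mem_coincidence_add (hR : IsSkew R α) {γ : C(Circ, Circ)} {i j k : ℤ} {θ : Circ} :
    θ + k • α ∈ coincidence R α γ i j ↔ θ ∈ coincidence R α γ (i + k) (j + k) := by
  change coord R α γ i _ = coord R α γ j _ ↔ coord R α γ _ θ = coord R α γ _ θ
  rw [hR.coord_add, hR.coord_add]
  exact (hR.fib_injective k θ).eq_iff

theorem IsSkew.flatAt_coincidence_add (hR : IsSkew R α) {γ : C(Circ, Circ)} {i j k : ℤ} {θ : Circ} :
    FlatAt (coincidence R α γ i j) (θ + k • α) ↔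
      FlatAt (coincidence R α γ (i + k) (j + k)) θ := by
  constructor
  · exact FlatAt.translate fun x => hR.mem_coincidence_add.symm
  · intro h
    have h' : FlatAt (coincidence R α γ (i + k) (j + k)) (θ + k • α + (-k) • α) := by
      simpa using h
    refine FlatAt.translate (fun x => ?_) h'
    have := hR.mem_coincidence_add (γ := γ) (i := i) (j := j) (k := k) (θ := x + (-k) • α)
    rw [← this, neg_zsmul, neg_add_cancel_right]

theorem coincidence_comm (γ : C(Circ, Circ)) (i j : ℤ) :
    coincidence R α γ i j = coincidence R α γ j i := by
  ext θ
  exact eq_comm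

/-- Over `K` the pair of curves takes values off the diagonal, which is open in the compact-open
topology. -/
theorem isOpen_setOf_disjoint_coincidence {K : Set Circ} (hK : IsCompact K) (i j : ℤ) :
    IsOpen {γ : C(Circ, Circ) | ∀ θ ∈ K, θ ∉ coincidence R α γ i j} := by
  have hc : Continuous fun γ : C(Circ, Circ) =>
      (⟨fun θ => (coord R α γ i θ, coord R α γ j θ), by fun_prop⟩ : C(Circ, Circ × Circ)) := by
    apply ContinuousMap.continuous_of_continuous_uncurry
    simp only [Function.uncurry_def, ContinuousMap.coe_mk, coord]
    fun_prop
  have hU : IsOpen {p : Circ × Circ | p.1 ≠ p.2} := isOpen_ne_fun continuous_fst continuous_snd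
  exact (ContinuousMap.isOpen_setOfPred_mapsTo hK hU).preimage hc

/-! ### Perturbations along orbit segments -/

/-- Translate the fibre coordinate of `γ` at time `m` by `τ`. -/
def shiftAt (R : Torus ≃ₜ Torus) (α : Circ) (τ γ : C(Circ, Circ)) (m : ℤ) : C(Circ, Circ) :=
  ⟨fun θ => fib R m (θ - m • α, fib R (-m) (θ, γ θ) + τ (θ - m • α)), by fun_prop⟩

/-- Translate the fibre coordinates of `γ` at the times `r, …, r + n - 1` by `τ`. -/
def shiftRange (R : Torus ≃ₜ Torus) (α : Circ) (τ γ : C(Circ, Circ)) (r : ℤ) : ℕ → C(Circ, Circ)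
  | 0 => γ
  | n + 1 => shiftAt R α τ (shiftRange R α τ γ r n) (r + n)

theorem continuous_shiftRange (r : ℤ) (n : ℕ) :
    Continuous fun p : C(Circ, Circ) × C(Circ, Circ) => shiftRange R α p.1 p.2 r n := by
  induction n with
  | zero => exact continuous_snd
  | succ n ih =>
    apply ContinuousMap.continuous_of_continuous_uncurry
    simp only [Function.uncurry_def, shiftRange, shiftAt, ContinuousMap.coe_mk]
    fun_prop

theorem IsSkew.shiftAt_apply_of_eq_zero (hR : IsSkew R α) {τ γ : C(Circ, Circ)} {m : ℤ} {θ : Circ}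
    (h : τ (θ - m • α) = 0) : shiftAt R α τ γ m θ = γ θ := by
  have h2 := hR.fib_add m (-m) θ (γ θ)
  rw [add_neg_cancel, fib_zero, neg_zsmul, ← sub_eq_add_neg] at h2
  simp only [shiftAt, ContinuousMap.coe_mk, h, add_zero]
  exact h2.symm

theorem IsSkew.shiftRange_apply_of_eq_zero (hR : IsSkew R α) {τ γ : C(Circ, Circ)} {r : ℤ} {n : ℕ}
    {θ : Circ} (h : ∀ m, r ≤ m → m < r + n → τ (θ - m • α) = 0) :
    shiftRange R α τ γ r n θ = γ θ := by
  induction n with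
  | zero => rfl
  | succ n ih =>
    rw [shiftRange, hR.shiftAt_apply_of_eq_zero (h _ (by omega) (by push_cast; omega))]
    exact ih fun m h1 h2 => h m h1 (by push_cast; omega)

theorem IsSkew.shiftRange_zero (hR : IsSkew R α) (γ : C(Circ, Circ)) (r : ℤ) (n : ℕ) :
    shiftRange R α 0 γ r n = γ := by
  ext θ
  exact hR.shiftRange_apply_of_eq_zero fun _ _ _ => rfl

/-- At `u + kα` every shift except the one at time `k` is trivial, and that one evaluates `τ` at
`u`. -/
theorem IsSkew.shiftRange_apply (hR : IsSkew R α) {τ γ : C(Circ, Circ)} {r : ℤ} {n : ℕ}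
    {u : Circ} {k : ℤ} (hk : r ≤ k) (hk' : k < r + n)
    (h : ∀ m, r ≤ m → m < r + n → m ≠ k → τ (u + k • α - m • α) = 0) :
    shiftRange R α τ γ r n (u + k • α) = fib R k (u, coord R α γ k u + τ u) := by
  induction n with
  | zero => push_cast at hk'; omega
  | succ n ih =>
    push_cast at hk'
    rw [shiftRange]
    by_cases hkn : k = r + n
    · subst hkn
      have h0 : shiftRange R α τ γ r n (u + (r + n : ℤ) • α) = γ (u + (r + n : ℤ) • α) :=
        hR.shiftRange_apply_of_eq_zero fun m h1 h2 => h m h1 (by push_cast; omega) (by omega)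
      simp only [shiftAt, ContinuousMap.coe_mk, h0, add_sub_cancel_right]
      rfl
    · rw [hR.shiftAt_apply_of_eq_zero (h _ (by omega) (by push_cast; omega) (Ne.symm hkn))]
      exact ih (by omega) fun m h1 h2 h3 => h m h1 (by push_cast; omega) h3

end

section

/-! ### Crossing finitely many curves in a flat way -/

theorem eventually_coe_ne (y : ℝ) (c : Circ) : ∀ᶠ b : ℝ in 𝓝[≠] y, (b : Circ) ≠ c := by
  by_cases h : (y : Circ) = c
  · have h1 : ∀ᶠ b in 𝓝[≠] y, |b - y| < 1 := by
      refine nhdsWithin_le_nhds ?_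
      filter_upwards [Metric.ball_mem_nhds y one_pos] with b hb
      rwa [Metric.mem_ball, Real.dist_eq] at hb
    filter_upwards [h1, self_mem_nhdsWithin] with b hb hby hbc
    refine coe_ne_zero_of_abs_lt_one (sub_ne_zero.2 hby) hb ?_
    rw [AddCircle.coe_sub, hbc, h, sub_self]
  · exact nhdsWithin_le_nhds (continuous_coe.continuousAt.eventually_ne h)

theorem flatAtReal_of_iff_mem_Icc {A : Set ℝ} {p q t : ℝ} (hpq : p < q)
    (h : ∀ᶠ s in 𝓝 t, (s ∈ A ↔ s ∈ Icc p q)) : FlatAtReal A t := by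
  refine FlatAtReal.congr (h.mono fun s hs => hs.symm) ?_
  rintro ⟨h1, h2⟩
  rcases h1.eq_or_lt with rfl | h1
  · refine Or.inr (Or.inl ?_)
    filter_upwards [Iio_mem_nhds hpq] with s hs
    exact ⟨fun h => h.1, fun h => ⟨h, le_of_lt hs⟩⟩
  rcases h2.eq_or_lt with rfl | h2
  · refine Or.inr (Or.inr ?_)
    filter_upwards [Ioi_mem_nhds hpq] with s hs
    exact ⟨fun h => h.2, fun h => ⟨le_of_lt hs, h⟩⟩
  · exact Or.inl (Icc_mem_nhds h1 h2)

theorem abs_add_mul_sub_lt {s v w κ : ℝ} (h0 : 0 ≤ s) (h1 : s ≤ 1) (hw : |w| < κ) (hv : |v| < κ) :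
    |w + s * (v - w)| < κ := by
  have h := (convex_Ioo (-κ) κ) (abs_lt.1 hw) (abs_lt.1 hv) (sub_nonneg.2 h1) h0 (by ring)
  rw [abs_lt]
  simp only [smul_eq_mul, mem_Ioo] at h
  constructor <;> linarith [h.1, h.2]

variable {ι : Type*} (d : ι → ℝ → Circ) (δ : ℝ)

/-- The constant `y` is not the value at `t` of one of the curves. -/
def IsFree (y t : ℝ) : Prop := ∀ i, (y : Circ) ≠ d i t

/-- There is a small function from `y` at `p` to `z` at `q` meeting the curves in flat sets. -/
def HasFlatPath (p q y z : ℝ) : Prop :=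
  ∃ τ : ℝ → ℝ, Continuous τ ∧ τ p = y ∧ τ q = z ∧ (∀ t ∈ Icc p q, |τ t| < δ) ∧
    ∀ t ∈ Ioo p q, ∀ i, FlatAtReal {s | (τ s : Circ) = d i s} t

variable {d δ}

/-- The junction value is free, so the glued function meets no curve at `q` and no one-sided
behaviours need matching. -/
theorem HasFlatPath.trans {p q r x y z : ℝ} (hpq : p < q) (hqr : q < r) (hy : IsFree d y q)
    (h₁ : HasFlatPath d δ p q x y) (h₂ : HasFlatPath d δ q r y z) : HasFlatPath d δ p r x z := by
  obtain ⟨τ₁, c₁, hp₁, hq₁, hb₁, hf₁⟩ := h₁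
  obtain ⟨τ₂, c₂, hp₂, hq₂, hb₂, hf₂⟩ := h₂
  refine ⟨fun t => if t ≤ q then τ₁ t else τ₂ t, ?_, ?_, ?_, ?_, ?_⟩
  · refine Continuous.if_le c₁ c₂ continuous_id continuous_const ?_
    rintro t rfl
    rw [hq₁, hp₂]
  · simp [hpq.le, hp₁]
  · simp [not_le.2 hqr, hq₂]
  · intro t ht
    by_cases h : t ≤ q
    · simp only [h, if_true]
      exact hb₁ t ⟨ht.1, h⟩
    · simp only [h, if_false]
      exact hb₂ t ⟨(not_le.1 h).le, ht.2⟩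
  · intro t ht i
    rcases lt_trichotomy t q with h | rfl | h
    · refine FlatAtReal.congr ?_ (hf₁ t ⟨ht.1, h⟩ i)
      filter_upwards [Iio_mem_nhds h] with s hs
      rw [if_pos (mem_Iio.1 hs).le]
    · refine FlatAtReal.of_notMem ?_
      change ¬ ((if t ≤ t then τ₁ t else τ₂ t : ℝ) : Circ) = d i t
      rw [if_pos le_rfl, hq₁]
      exact hy i
    · refine FlatAtReal.congr ?_ (hf₂ t ⟨h, ht.2⟩ i)
      filter_upwards [Ioi_mem_nhds h] with s hs
      rw [if_neg (not_le.2 (mem_Ioi.1 hs))]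

theorem HasFlatPath.const {p q y : ℝ} (hy : |y| < δ) (h : ∀ t ∈ Icc p q, IsFree d y t) :
    HasFlatPath d δ p q y y :=
  ⟨fun _ => y, continuous_const, rfl, rfl, fun _ _ => hy, fun t ht i =>
    FlatAtReal.of_notMem (h t (Ioo_subset_Icc_self ht) i)⟩

theorem isOpen_setOf_isFree [Finite ι] (hd : ∀ i, Continuous (d i)) (y : ℝ) :
    IsOpen {t | IsFree d y t} := by
  simp only [IsFree, ofPred_forall]
  exact isOpen_iInter_of_finite fun i => isOpen_ne_fun continuous_const (hd i)

theorem eventually_isFree [Finite ι] (y t : ℝ) : ∀ᶠ b in 𝓝[≠] y, IsFree d b t :=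
  eventually_all.2 fun _ => eventually_coe_ne _ _

theorem exists_isFree [Finite ι] (hδ : 0 < δ) (t : ℝ) : ∃ y, |y| < δ ∧ IsFree d y t := by
  have h1 : ∀ᶠ b in 𝓝[≠] (0 : ℝ), |b| < δ := by
    refine nhdsWithin_le_nhds ?_
    filter_upwards [Metric.ball_mem_nhds 0 hδ] with b hb
    simpa using hb
  exact (h1.and (eventually_isFree 0 t)).exists

/-- Near a parameter where the coincidences between the curves are locally constant, one crosses
a given level. -/
theorem exists_hasFlatPath_near_level [Finite ι] (hd : ∀ i, Continuous (d i)) {u : ℝ}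
    (hu : ∀ i j, (∀ᶠ t in 𝓝 u, d i t = d j t) ∨ ∀ᶠ t in 𝓝 u, d i t ≠ d j t)
    {e : ℝ} (he : |e| < δ) :
    ∃ κ > 0, ∀ x x', |x - e| < κ → |x' - e| < κ → IsFree d x u → IsFree d x' u →
      ∃ ρ > 0, ∀ p q, u - ρ < p → p < q → q < u + ρ → HasFlatPath d δ p q x x' := by
  -- By `hu`, the curves through level `e` at `u` all agree near `u`, so one real lift `e + w`
  -- describes them.
  obtain ⟨w, hw, hw0, hwd⟩ : ∃ w : ℝ → ℝ, Continuous w ∧ w u = 0 ∧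
      ∀ i, d i u = (e : Circ) → ∀ᶠ t in 𝓝 u, d i t = ((e + w t : ℝ) : Circ) := by
    by_cases h : ∃ i, d i u = (e : Circ)
    · obtain ⟨i, hi⟩ := h
      refine ⟨fun t => signedNorm (d i t - e), continuous_signedNorm.comp
          ((hd i).sub continuous_const),
        ?_, fun j hj => ?_⟩
      · have := abs_signedNorm_le (0 : Circ)
        simpa [hi] using this
      · have hij : ∀ᶠ t in 𝓝 u, d i t = d j t := (hu i j).resolve_right fun h =>
          h.self_of_nhds (hi.trans hj.symm)
        have hn : ∀ᶠ t in 𝓝 u, ‖d i t - e‖ < 1 / 4 := by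
          have hc : Continuous fun t => ‖d i t - e‖ := ((hd i).sub continuous_const).norm
          exact hc.continuousAt.eventually_lt continuousAt_const (by simp [hi])
        filter_upwards [hij, hn] with t h1 h2
        rw [← h1, AddCircle.coe_add, coe_signedNorm h2.le]
        abel
    · push Not at h
      exact ⟨0, continuous_const, rfl, fun i hi => absurd hi (h i)⟩
  -- The remaining curves stay away from a small box around `(e, u)`, so only `e + w` matters there.
  have hfar : ∀ᶠ z : ℝ × ℝ in 𝓝 (e, u), |z.1| < δ ∧ ∀ i, d i u ≠ (e : Circ) →
      (z.1 : Circ) ≠ d i z.2 := by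
    refine Filter.Eventually.and ?_ (eventually_all.2 fun i => ?_)
    · exact (continuous_fst.abs).continuousAt.eventually_lt continuousAt_const he
    · by_cases hi : d i u = (e : Circ)
      · exact Eventually.of_forall fun _ h => absurd hi h
      · have hc1 : Continuous fun z : ℝ × ℝ => (z.1 : Circ) := continuous_coe.comp continuous_fst
        have hc2 : Continuous fun z : ℝ × ℝ => d i z.2 := (hd i).comp continuous_snd
        exact mem_of_superset ((isOpen_ne_fun hc1 hc2).mem_nhds (Ne.symm hi)) fun _ h _ => h
  obtain ⟨κ₀, hκ₀, hfar⟩ := Metric.eventually_nhds_iff.1 hfar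
  -- With `1/4`, the path and the curve `e + w` differ by less than `1`, so equality on the circle
  -- is equality of real numbers.
  refine ⟨min κ₀ (1 / 4), by positivity, fun x x' hx hx' hfx hfx' => ?_⟩
  set κ := min κ₀ (1 / 4) with hκ
  have hκpos : 0 < κ := by positivity
  have hnear : ∀ᶠ t in 𝓝 u, |t - u| < κ₀ ∧ |w t| < κ ∧
      ∀ i, d i u = (e : Circ) → d i t = ((e + w t : ℝ) : Circ) ∧ w t ≠ x - e ∧ w t ≠ x' - e := by
    refine Filter.Eventually.and ?_ (Filter.Eventually.and ?_ (eventually_all.2 fun i => ?_))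
    · exact Metric.ball_mem_nhds u hκ₀
    · exact hw.abs.continuousAt.eventually_lt continuousAt_const (by simpa [hw0] using hκpos)
    · by_cases hi : d i u = (e : Circ)
      · have h1 : w u ≠ x - e := by
          rw [hw0]
          rintro h
          exact hfx i (by rw [hi, sub_eq_zero.1 h.symm])
        have h2 : w u ≠ x' - e := by
          rw [hw0]
          rintro h
          exact hfx' i (by rw [hi, sub_eq_zero.1 h.symm])
        filter_upwards [hwd i hi, hw.continuousAt.eventually_ne h1,
          hw.continuousAt.eventually_ne h2] with t h3 h4 h5 _
        exact ⟨h3, h4, h5⟩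
      · exact Eventually.of_forall fun _ h => absurd h hi
  obtain ⟨ρ, hρ, hnear⟩ := Metric.eventually_nhds_iff.1 hnear
  refine ⟨ρ, hρ, fun p q hp hpq hq => ?_⟩
  have hI : ∀ t ∈ Icc p q, dist t u < ρ := fun t ht => by
    rw [Real.dist_eq, abs_lt]
    constructor <;> linarith [ht.1, ht.2]
  -- The path joins the curve `e + w` during the first third, follows it during the second and
  -- leaves it for `x'` during the last. `A` and `B` are the weights of the two end levels.
  set ℓ := (q - p) / 3 with hℓ
  have hℓ0 : 0 < ℓ := by rw [hℓ]; linarith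
  have hq3 : q = p + 3 * ℓ := by rw [hℓ]; ring
  set A : ℝ → ℝ := fun t => max 0 (1 - (t - p) / ℓ) with hA
  set B : ℝ → ℝ := fun t => max 0 ((t - p) / ℓ - 2) with hB
  have hAc : Continuous A := by fun_prop
  have hBc : Continuous B := by fun_prop
  have hA1 : ∀ t, p ≤ t → 0 ≤ A t ∧ A t ≤ 1 := fun t ht =>
    ⟨le_max_left _ _, max_le zero_le_one (by have := div_nonneg (sub_nonneg.2 ht) hℓ0.le; linarith)⟩
  have hB1 : ∀ t, t ≤ q → 0 ≤ B t ∧ B t ≤ 1 := fun t ht =>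
    ⟨le_max_left _ _, max_le zero_le_one (by
      have : (t - p) / ℓ ≤ 3 := by rw [div_le_iff₀ hℓ0]; linarith
      linarith)⟩
  have hA0 : ∀ t, A t = 0 ↔ p + ℓ ≤ t := fun t => by
    simp only [hA, max_eq_left_iff]
    rw [sub_nonpos, le_div_iff₀ hℓ0]
    constructor <;> intro h <;> linarith
  have hB0 : ∀ t, B t = 0 ↔ t ≤ p + 2 * ℓ := fun t => by
    simp only [hB, max_eq_left_iff]
    rw [sub_nonpos, div_le_iff₀ hℓ0]
    constructor <;> intro h <;> linarith
  set τ : ℝ → ℝ := fun t => e + w t + A t * (x - e - w t) + B t * (x' - e - w t) with hτ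
  have hbound : ∀ t ∈ Icc p q, |τ t - e| < κ := by
    intro t ht
    obtain ⟨-, hwt, -⟩ := hnear (hI t ht)
    obtain ⟨a0, a1⟩ := hA1 t ht.1
    obtain ⟨b0, b1⟩ := hB1 t ht.2
    rcases le_total t (p + 2 * ℓ) with h | h
    · have hb := (hB0 t).2 h
      have := abs_add_mul_sub_lt a0 a1 hwt hx
      simp only [hτ, hb]
      convert this using 2
      ring
    · have ha := (hA0 t).2 (by linarith)
      have := abs_add_mul_sub_lt b0 b1 hwt hx'
      simp only [hτ, ha]
      convert this using 2
      ring
  refine ⟨τ, by fun_prop, ?_, ?_, fun t ht => ?_, fun t ht i => ?_⟩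
  · have h1 : A p = 1 := by simp [hA]
    have h2 : B p = 0 := (hB0 p).2 (by linarith)
    simp only [hτ, h1, h2]
    ring
  · have h1 : A q = 0 := (hA0 q).2 (by linarith)
    have h2 : B q = 1 := by
      have : (q - p) / ℓ = 3 := by rw [div_eq_iff hℓ0.ne']; linarith
      simp only [hB, this]
      norm_num
    simp only [hτ, h1, h2]
    ring
  · refine (hfar (y := (τ t, u)) ?_).1
    rw [Prod.dist_eq, dist_self, max_lt_iff]
    exact ⟨by rw [Real.dist_eq]; exact (hbound t ht).trans_le (min_le_left _ _), hκ₀⟩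
  · by_cases hi : d i u = (e : Circ)
    -- Since `w` avoids `x - e` and `x' - e` near `u`, the path meets the curve exactly on the
    -- middle third.
    · refine flatAtReal_of_iff_mem_Icc (p := p + ℓ) (q := p + 2 * ℓ) (by linarith) ?_
      filter_upwards [Ioo_mem_nhds ht.1 ht.2] with s hs
      have hs' := Ioo_subset_Icc_self hs
      obtain ⟨-, hws, hds⟩ := hnear (hI s hs')
      obtain ⟨h1, h2, h3⟩ := hds i hi
      have hbs := hbound s hs'
      change ((τ s : ℝ) : Circ) = d i s ↔ _
      rw [h1]
      constructor
      · intro h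
        have h4 : ((τ s - (e + w s) : ℝ) : Circ) = 0 := by rw [AddCircle.coe_sub, h, sub_self]
        have h5 : τ s - (e + w s) = 0 := by
          by_contra hne
          refine coe_ne_zero_of_abs_lt_one hne ?_ h4
          have hk := min_le_right κ₀ (1 / 4)
          rw [abs_lt] at hbs hws ⊢
          constructor <;> linarith
        simp only [hτ] at h5
        rcases le_total s (p + 2 * ℓ) with h6 | h6
        · refine ⟨(hA0 s).1 ?_, h6⟩
          have hb := (hB0 s).2 h6
          rw [hb] at h5
          have : A s * (x - e - w s) = 0 := by linarith
          exact (mul_eq_zero.1 this).resolve_right fun h7 => h2 (by linarith)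
        · refine ⟨by linarith, (hB0 s).1 ?_⟩
          have ha := (hA0 s).2 (by linarith)
          rw [ha] at h5
          have : B s * (x' - e - w s) = 0 := by linarith
          exact (mul_eq_zero.1 this).resolve_right fun h7 => h3 (by linarith)
      · rintro ⟨h4, h5⟩
        simp [hτ, (hA0 s).2 h4, (hB0 s).2 h5]
    · refine FlatAtReal.of_notMem ?_
      have ht' := Ioo_subset_Icc_self ht
      refine (hfar (y := (τ t, t)) ?_).2 i hi
      rw [Prod.dist_eq, max_lt_iff]
      exact ⟨by rw [Real.dist_eq]; exact (hbound t ht').trans_le (min_le_left _ _),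
        (hnear (hI t ht')).1⟩

/-- Nearby free levels can be joined by `exists_hasFlatPath_near_level`; connectedness of `(-δ, δ)`
propagates this to any two free levels. -/
theorem exists_hasFlatPath_near [Finite ι] (hd : ∀ i, Continuous (d i)) {u : ℝ}
    (hu : ∀ i j, (∀ᶠ t in 𝓝 u, d i t = d j t) ∨ ∀ᶠ t in 𝓝 u, d i t ≠ d j t)
    {y z : ℝ} (hy : |y| < δ) (hz : |z| < δ) (hfy : IsFree d y u) (hfz : IsFree d z u) :
    ∃ ρ > 0, ∀ p q, u - ρ < p → p < q → q < u + ρ → HasFlatPath d δ p q y z := by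
  set G : ℝ → ℝ → Prop := fun a b =>
    ∃ ρ > 0, ∀ p q, u - ρ < p → p < q → q < u + ρ → HasFlatPath d δ p q a b with hG
  have hGtrans : ∀ a b c, IsFree d b u → G a b → G b c → G a c := by
    rintro a b c hb ⟨ρ₁, hρ₁, h₁⟩ ⟨ρ₂, hρ₂, h₂⟩
    obtain ⟨ρ₃, hρ₃, h₃⟩ := Metric.eventually_nhds_iff.1 ((isOpen_setOf_isFree hd b).mem_nhds hb)
    refine ⟨min ρ₃ (min ρ₁ ρ₂), by positivity, fun p q hp hpq hq => ?_⟩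
    have e₁ : min ρ₃ (min ρ₁ ρ₂) ≤ ρ₁ := (min_le_right _ _).trans (min_le_left _ _)
    have e₂ : min ρ₃ (min ρ₁ ρ₂) ≤ ρ₂ := (min_le_right _ _).trans (min_le_right _ _)
    have e₃ : min ρ₃ (min ρ₁ ρ₂) ≤ ρ₃ := min_le_left _ _
    refine HasFlatPath.trans (q := (p + q) / 2) (by linarith) (by linarith) (h₃ ?_)
      (h₁ p _ (by linarith) (by linarith) (by linarith))
      (h₂ _ q (by linarith) (by linarith) (by linarith))
    rw [Real.dist_eq, abs_lt]
    constructor <;> linarith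
  -- Only free levels can be joined, while the induction runs over all levels. The relation
  -- therefore concerns free levels in neighbourhoods; free levels being dense, transitivity can
  -- pass through one of them.
  have hP := isPreconnected_Ioo.induction₂ (s := Ioo (-δ) δ)
    (fun x x' => ∃ A ∈ 𝓝 x, ∃ B ∈ 𝓝 x', ∀ a ∈ A, ∀ b ∈ B,
      IsFree d a u → IsFree d b u → G a b ∧ G b a) ?_ ?_ ?_ (abs_lt.1 hy) (abs_lt.1 hz)
  · obtain ⟨A, hA, B, hB, h⟩ := hP
    exact (h y (mem_of_mem_nhds hA) z (mem_of_mem_nhds hB) hfy hfz).1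
  · intro x hx
    obtain ⟨κ, hκ, h⟩ := exists_hasFlatPath_near_level hd hu (abs_lt.2 hx)
    refine nhdsWithin_le_nhds ?_
    filter_upwards [Metric.ball_mem_nhds x hκ] with x' hx'
    refine ⟨_, Metric.ball_mem_nhds x hκ, _, Metric.isOpen_ball.mem_nhds hx',
        fun a ha b hb hfa hfb => ?_⟩
    rw [Metric.mem_ball, Real.dist_eq] at ha hb
    exact ⟨h a b ha hb hfa hfb, h b a hb ha hfb hfa⟩
  · rintro x x₁ x₂ - - - ⟨A, hA, B, hB, h₁⟩ ⟨B', hB', C, hC, h₂⟩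
    have hfr : ∃ᶠ b in 𝓝 x₁, IsFree d b u :=
      ((eventually_isFree x₁ u).frequently).filter_mono nhdsWithin_le_nhds
    obtain ⟨b, hfb, hb, hb'⟩ := (hfr.and_eventually (inter_mem hB hB')).exists
    refine ⟨A, hA, C, hC, fun a ha c hc hfa hfc => ?_⟩
    have k₁ := h₁ a ha b hb hfa hfb
    have k₂ := h₂ b hb' c hc hfb hfc
    exact ⟨hGtrans a b c hfb k₁.1 k₂.1, hGtrans c b a hfb k₂.2 k₁.2⟩
  · rintro x x' - - ⟨A, hA, B, hB, h⟩
    exact ⟨B, hB, A, hA, fun b hb a ha hfb hfa => (h a ha b hb hfa hfb).symm⟩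

/-- For each pair of curves, the interior of the coincidence set together with its complement is
open and dense, and there are finitely many pairs. -/
theorem exists_locally_constant_pattern [Finite ι] (hd : ∀ i, Continuous (d i)) {p q : ℝ}
    (hpq : p < q) : ∃ u ∈ Ioo p q,
      ∀ i j, (∀ᶠ t in 𝓝 u, d i t = d j t) ∨ ∀ᶠ t in 𝓝 u, d i t ≠ d j t := by
  have hdense := dense_iInter_of_isOpen
    (f := fun ij : ι × ι => interior {t | d ij.1 t = d ij.2 t} ∪ {t | d ij.1 t ≠ d ij.2 t})
    (fun ij => isOpen_interior.union (isOpen_ne_fun (hd _) (hd _))) (fun ij => by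
      intro x
      by_contra hx
      have hx' : ∀ᶠ t in 𝓝 x, d ij.1 t = d ij.2 t := by
        rw [mem_closure_iff_frequently, not_frequently] at hx
        filter_upwards [hx] with t ht
        by_contra h
        exact ht (Or.inr h)
      exact hx (subset_closure (Or.inl (mem_interior_iff_mem_nhds.2 hx'))))
  obtain ⟨u, hu, hu'⟩ := hdense.exists_mem_open isOpen_Ioo (nonempty_Ioo.2 hpq)
  refine ⟨u, hu', fun i j => ?_⟩
  rcases mem_iInter.1 hu (i, j) with h | h
  · exact Or.inl (mem_interior_iff_mem_nhds.1 h)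
  · exact Or.inr ((isOpen_ne_fun (hd i) (hd j)).mem_nhds h)

/-- Both levels are free throughout, so one stays constant except for a change of level near a point
with locally constant pattern. -/
theorem hasFlatPath_of_isFree [Finite ι] (hd : ∀ i, Continuous (d i)) {p q y z : ℝ} (hpq : p < q)
    (hy : |y| < δ) (hz : |z| < δ) (hfy : ∀ t ∈ Icc p q, IsFree d y t)
    (hfz : ∀ t ∈ Icc p q, IsFree d z t) : HasFlatPath d δ p q y z := by
  obtain ⟨u, hu, hpat⟩ := exists_locally_constant_pattern hd hpq
  obtain ⟨ρ, hρ, h⟩ := exists_hasFlatPath_near hd hpat hy hz (hfy u (Ioo_subset_Icc_self hu))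
    (hfz u (Ioo_subset_Icc_self hu))
  obtain ⟨σ, hσ, hσρ, hσp, hσq⟩ : ∃ σ > 0, σ < ρ ∧ p < u - σ ∧ u + σ < q := by
    have h1 := sub_pos.2 hu.1
    have h2 := sub_pos.2 hu.2
    refine ⟨min ρ (min (u - p) (q - u)) / 2, by positivity, ?_, ?_, ?_⟩
    all_goals
      have e1 : min ρ (min (u - p) (q - u)) ≤ ρ := min_le_left _ _
      have e2 : min ρ (min (u - p) (q - u)) ≤ u - p := (min_le_right _ _).trans (min_le_left _ _)
      have e3 : min ρ (min (u - p) (q - u)) ≤ q - u := (min_le_right _ _).trans (min_le_right _ _)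
      have e0 : 0 < min ρ (min (u - p) (q - u)) := by positivity
      linarith
  refine HasFlatPath.trans hσp (by linarith) (hfy _ ⟨hσp.le, by linarith⟩)
    (HasFlatPath.const hy fun t ht => hfy t ⟨ht.1, by linarith [ht.2]⟩) ?_
  exact HasFlatPath.trans (q := u + σ) (by linarith) hσq (hfz _ ⟨by linarith, hσq.le⟩)
    (h _ _ (by linarith) (by linarith) (by linarith))
    (HasFlatPath.const hz fun t ht => hfz t ⟨by linarith [ht.1], ht.2⟩)

/-- The end levels stay free only near their own ends; between, the path rests at `y`. Each exchange
takes place where both levels involved are free. -/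
theorem hasFlatPath_of_exists_isFree [Finite ι] (hd : ∀ i, Continuous (d i)) {p q x y z : ℝ}
    (hpq : p < q) (hx : |x| < δ) (hy : |y| < δ) (hz : |z| < δ) (hfx : IsFree d x p)
    (hfz : IsFree d z q) (hfy : ∀ t ∈ Icc p q, IsFree d y t) : HasFlatPath d δ p q x z := by
  obtain ⟨ε₁, hε₁, h₁⟩ := Metric.eventually_nhds_iff.1 ((isOpen_setOf_isFree hd x).mem_nhds hfx)
  obtain ⟨ε₂, hε₂, h₂⟩ := Metric.eventually_nhds_iff.1 ((isOpen_setOf_isFree hd z).mem_nhds hfz)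
  obtain ⟨ε, hε, l1, l2, l3⟩ : ∃ ε > 0, ε < ε₁ ∧ ε < ε₂ ∧ p + ε < q - ε := by
    have h0 := sub_pos.2 hpq
    refine ⟨min (q - p) (min ε₁ ε₂) / 3, by positivity, ?_, ?_, ?_⟩
    all_goals
      have e1 : min (q - p) (min ε₁ ε₂) ≤ q - p := min_le_left _ _
      have e2 : min (q - p) (min ε₁ ε₂) ≤ ε₁ := (min_le_right _ _).trans (min_le_left _ _)
      have e3 : min (q - p) (min ε₁ ε₂) ≤ ε₂ := (min_le_right _ _).trans (min_le_right _ _)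
      have e0 : 0 < min (q - p) (min ε₁ ε₂) := by positivity
      linarith
  refine HasFlatPath.trans (q := p + ε) (y := y) (by linarith) (by linarith)
    (hfy _ ⟨by linarith, by linarith⟩) ?_
    (HasFlatPath.trans (q := q - ε) l3 (by linarith) (hfy _ ⟨by linarith, by linarith⟩)
      (HasFlatPath.const hy fun t ht => hfy t ⟨by linarith [ht.1], by linarith [ht.2]⟩) ?_)
  · refine hasFlatPath_of_isFree hd (by linarith) hx hy (fun t ht => h₁ ?_)
      (fun t ht => hfy t ⟨ht.1, by linarith [ht.2]⟩)
    rw [Real.dist_eq, abs_lt]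
    constructor <;> linarith [ht.1, ht.2]
  · refine hasFlatPath_of_isFree hd (by linarith) hy hz
        (fun t ht => hfy t ⟨by linarith [ht.1], ht.2⟩)
      (fun t ht => h₂ ?_)
    rw [Real.dist_eq, abs_lt]
    constructor <;> linarith [ht.1, ht.2]

/-- A Lebesgue number for the cover by the free sets of the levels gives short intervals, each with
a level free throughout; the pieces are then chained. -/
theorem hasFlatPath [Finite ι] (hd : ∀ i, Continuous (d i)) {a b y z : ℝ} (hab : a < b)
    (hy : |y| < δ) (hz : |z| < δ) (hfy : IsFree d y a) (hfz : IsFree d z b) :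
    HasFlatPath d δ a b y z := by
  have hδ : 0 < δ := (abs_nonneg y).trans_lt hy
  obtain ⟨η, hη, hleb⟩ := lebesgue_number_lemma_of_metric (isCompact_Icc (a := a) (b := b))
    (c := fun y : {y : ℝ // |y| < δ} => {t | IsFree d y t})
    (fun y => isOpen_setOf_isFree hd y) (fun t _ => by
      obtain ⟨y, hy, hf⟩ := exists_isFree (d := d) hδ t
      exact mem_iUnion.2 ⟨⟨y, hy⟩, hf⟩)
  have key : ∀ n : ℕ, ∀ p q y z : ℝ, a ≤ p → p < q → q ≤ b → q - p ≤ n * (η / 2) → |y| < δ →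
      |z| < δ → IsFree d y p → IsFree d z q → HasFlatPath d δ p q y z := by
    intro n
    induction n with
    | zero =>
      intro p q y z _ hpq _ h
      simp only [Nat.cast_zero, zero_mul] at h
      linarith
    | succ n ih =>
      intro p q y z hp hpq hq h hy hz hfy hfz
      push_cast at h
      by_cases hs : q - p ≤ η / 2
      · obtain ⟨⟨x, hx⟩, hsub⟩ := hleb p ⟨hp, by linarith⟩
        refine hasFlatPath_of_exists_isFree hd hpq hy hx hz hfy hfz fun t ht => hsub ?_
        rw [Metric.mem_ball, Real.dist_eq, abs_lt]
        constructor <;> linarith [ht.1, ht.2]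
      · obtain ⟨x, hx, hfx⟩ := exists_isFree (d := d) hδ (p + η / 2)
        obtain ⟨⟨x', hx'⟩, hsub⟩ := hleb p ⟨hp, by linarith⟩
        refine HasFlatPath.trans (q := p + η / 2) (y := x) (by linarith) (by linarith) hfx ?_
          (ih _ _ _ _ (by linarith) (by linarith) hq (by linarith) hx hz hfx hfz)
        refine hasFlatPath_of_exists_isFree hd (by linarith) hy hx' hx hfy hfx fun t ht => hsub ?_
        rw [Metric.mem_ball, Real.dist_eq, abs_lt]
        constructor <;> linarith [ht.1, ht.2]
  obtain ⟨n, hn⟩ := exists_nat_ge ((b - a) / (η / 2))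
  exact key n a b y z le_rfl hab le_rfl (by rwa [div_le_iff₀ (by positivity)] at hn) hy hz hfy hfz

/-- A small function on the circle, vanishing off an arc, which meets finitely many curves over
this arc in flat sets. -/
theorem exists_flat_perturbation [Finite ι] (hd : ∀ i, Continuous (d i)) {a b : ℝ} (hab : a < b)
    (hab1 : b < a + 1) (ha : ∀ i, d i a ≠ 0) (hb : ∀ i, d i b ≠ 0) (hδ : 0 < δ) :
    ∃ τ : C(Circ, Circ), (∀ x, ‖τ x‖ < δ) ∧ (∀ x, x ∉ ((↑) : ℝ → Circ) '' Ioo a b → τ x = 0) ∧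
      ∀ t ∈ Ioo a b, ∀ i, FlatAtReal {s : ℝ | τ (s : Circ) = d i s} t := by
  -- The hypotheses `ha` and `hb` say that the level `0` is free at both ends.
  obtain ⟨σ, hσ, hσa, hσb, hσδ, hflat⟩ := hasFlatPath (y := 0) (z := 0) (δ := δ) hd hab
    (by simpa) (by simpa) (fun i => by simpa using (ha i).symm)
        (fun i => by simpa using (hb i).symm)
  -- Clamping to `[a, b]` makes `f` vanish beyond `b`, so its values at `a` and `a + 1` agree and it
  -- descends continuously to the circle.
  set f : ℝ → Circ := fun t => ((σ (projIcc a b hab.le t) : ℝ) : Circ) with hf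
  have hfc : Continuous f := continuous_coe.comp
      (hσ.comp (continuous_subtype_val.comp continuous_projIcc))
  have hfa : f a = 0 := by simp [hf, hσa]
  have hfb : ∀ t, b ≤ t → f t = 0 := fun t ht => by simp [hf, projIcc_of_right_le _ ht, hσb]
  have hτc : Continuous (AddCircle.liftIco 1 a f) :=
    AddCircle.liftIco_continuous (by rw [hfa, hfb _ hab1.le]) hfc.continuousOn
  have hval : ∀ t ∈ Ico a (a + 1), AddCircle.liftIco 1 a f (t : Circ) = f t := fun t ht =>
    AddCircle.liftIco_coe_apply ht
  have hrep : ∀ x : Circ, ∃ t ∈ Ico a (a + 1), (t : Circ) = x := fun x => by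
    have : x ∈ ((↑) : ℝ → Circ) '' Ico a (a + 1) := by
      rw [AddCircle.coe_image_Ico_eq]
      trivial
    exact this
  refine ⟨⟨_, hτc⟩, fun x => ?_, fun x hx => ?_, fun t ht i => ?_⟩
  · obtain ⟨t, ht, rfl⟩ := hrep x
    rw [ContinuousMap.coe_mk, hval t ht]
    exact (norm_coe_le_abs _).trans_lt (hσδ _ (projIcc a b hab.le t).2)
  · obtain ⟨t, ht, rfl⟩ := hrep x
    rw [ContinuousMap.coe_mk, hval t ht]
    rcases ht.1.eq_or_lt with rfl | h1
    · exact hfa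
    · refine hfb t (not_lt.1 fun h2 => hx ⟨t, ⟨h1, h2⟩, rfl⟩)
  · refine FlatAtReal.congr ?_ (hflat t ht i)
    filter_upwards [Ioo_mem_nhds ht.1 ht.2] with s hs
    change (σ s : Circ) = d i s ↔ AddCircle.liftIco 1 a f s = d i s
    rw [hval s ⟨hs.1.le, by linarith [hs.2]⟩, hf]
    simp only [projIcc_of_mem hab.le (Ioo_subset_Icc_self hs)]

end

section

/-! ### Cutting orbits along a closed set -/

/-- The orbit segment between the times `i` and `j` is cut by `V`. -/
def Separated (α : Circ) (V : Set Circ) (θ : Circ) (i j : ℤ) : Prop :=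
  ∃ m : ℤ, ((i ≤ m ∧ m < j) ∨ (j ≤ m ∧ m < i)) ∧ θ + m • α ∈ V

/-- The times `r, …, s` form a full uncut orbit segment for each point of `J`. -/
structure IsBox (α : Circ) (V J : Set Circ) (r s : ℤ) : Prop where
  nonpos : r ≤ 0
  nonneg : 0 ≤ s
  bot : ∀ u ∈ J, u + (r - 1) • α ∈ V
  top : ∀ u ∈ J, u + s • α ∈ V
  mid : ∀ u ∈ J, ∀ m, r ≤ m → m < s → u + m • α ∉ V

/-- Two graphs with the same coincidences along uncut orbit segments. -/
def Coherent (R : Torus ≃ₜ Torus) (α : Circ) (V : Set Circ) (γ γ' : C(Circ, Circ)) : Prop :=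
  ∀ θ i j, ¬ Separated α V θ i j → (θ ∈ coincidence R α γ' i j ↔ θ ∈ coincidence R α γ i j)

variable {R : Torus ≃ₜ Torus} {α : Circ} {V J : Set Circ} {r s : ℤ}

theorem eq_add_sub_zsmul {u u' : Circ} {m m' : ℤ} (he : u + m • α = u' + m' • α) :
    u = u' + (m' - m) • α := by
  rw [sub_zsmul, ← sub_eq_add_neg, ← add_sub_assoc, ← he, add_sub_cancel_right]

theorem Separated.symm {θ : Circ} {i j : ℤ} (h : Separated α V θ i j) : Separated α V θ j i := by
  obtain ⟨m, h1, h2⟩ := h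
  exact ⟨m, h1.symm, h2⟩

theorem Separated.mono {V' : Set Circ} {θ : Circ} {i j : ℤ} (h : Separated α V θ i j)
    (hV : V ⊆ V') : Separated α V' θ i j := by
  obtain ⟨m, h1, h2⟩ := h
  exact ⟨m, h1, hV h2⟩

theorem separated_add {θ : Circ} {i j k : ℤ} :
    Separated α V (θ + k • α) i j ↔ Separated α V θ (i + k) (j + k) := by
  constructor
  · rintro ⟨m, h1, h2⟩
    refine ⟨m + k, by omega, ?_⟩
    rwa [add_comm m k, add_zsmul, ← add_assoc]
  · rintro ⟨m, h1, h2⟩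
    refine ⟨m - k, by omega, ?_⟩
    rwa [add_assoc, ← add_zsmul, add_sub_cancel]

/-- Finitely many times are involved, and avoiding a closed set is an open condition. -/
theorem eventually_not_separated (hV : IsClosed V) {θ : Circ} {i j : ℤ}
    (h : ¬ Separated α V θ i j) : ∀ᶠ x in 𝓝 θ, ¬ Separated α V x i j := by
  have h1 : ∀ m ∈ Finset.Ico (min i j) (max i j), ∀ᶠ x in 𝓝 θ, x + m • α ∉ V := by
    intro m hm
    rw [Finset.mem_Ico] at hm
    have hc : Continuous fun x : Circ => x + m • α := continuous_id.add continuous_const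
    refine (hV.isOpen_compl.preimage hc).mem_nhds fun hx => h ⟨m, ?_, hx⟩
    omega
  filter_upwards [(Filter.eventually_all_finset _).2 h1] with x hx
  rintro ⟨m, hm, hmV⟩
  refine hx m ?_ hmV
  rw [Finset.mem_Ico]
  omega

theorem Coherent.refl (γ : C(Circ, Circ)) : Coherent R α V γ γ := fun _ _ _ _ => Iff.rfl

theorem Coherent.trans {γ₁ γ₂ γ₃ : C(Circ, Circ)} (h₁ : Coherent R α V γ₁ γ₂)
    (h₂ : Coherent R α V γ₂ γ₃) : Coherent R α V γ₁ γ₃ :=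
  fun θ i j h => (h₂ θ i j h).trans (h₁ θ i j h)

theorem Coherent.flatAt (hV : IsClosed V) {γ γ' : C(Circ, Circ)} (h : Coherent R α V γ γ')
    {θ : Circ} {i j : ℤ} (hs : ¬ Separated α V θ i j) (hf : FlatAt (coincidence R α γ i j) θ) :
    FlatAt (coincidence R α γ' i j) θ :=
  hf.congr ((eventually_not_separated hV hs).mono fun x hx => (h x i j hx).symm)

theorem IsBox.mono {J' : Set Circ} (h : IsBox α V J r s) (hJ : J' ⊆ J) : IsBox α V J' r s :=
  ⟨h.1, h.2, fun u hu => h.3 u (hJ hu), fun u hu => h.4 u (hJ hu), fun u hu => h.5 u (hJ hu)⟩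

/-- A visit to `V` at time `m` cuts between `m` and `m + 1`, so the visits at `r - 1` and `s`
isolate the block `r, …, s`. -/
theorem IsBox.separated (h : IsBox α V J r s) {u : Circ} (hu : u ∈ J) {k l : ℤ} (h1 : r ≤ k)
    (h2 : k ≤ s) (hl : l < r ∨ s < l) : Separated α V u k l := by
  rcases hl with hl | hl
  · exact ⟨r - 1, by omega, h.bot u hu⟩
  · exact ⟨s, by omega, h.top u hu⟩

theorem IsBox.not_separated (h : IsBox α V J r s) {u : Circ} (hu : u ∈ J) {k l : ℤ} (h1 : r ≤ k)
    (h2 : k ≤ s) (h3 : r ≤ l) (h4 : l ≤ s) : ¬ Separated α V u k l := by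
  rintro ⟨m, hm, hmV⟩
  exact h.mid u hu m (by omega) (by omega) hmV

/-- The translates of `J` in a box are disjoint: an overlap at times `m < m'` would turn the visit
of one point at time `r - 1` into a forbidden visit of the other inside `[r, s)`. -/
theorem IsBox.eq_of_add_eq (h : IsBox α V J r s) {u u' : Circ} (hu : u ∈ J) (hu' : u' ∈ J)
    {m m' : ℤ} (h1 : r ≤ m) (h2 : m ≤ s) (h3 : r ≤ m') (h4 : m' ≤ s)
    (he : u + m • α = u' + m' • α) : m = m' := by
  have key : ∀ {u u' : Circ} {m m' : ℤ}, u ∈ J → u' ∈ J → r ≤ m → m' ≤ s → m < m' →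
      u + m • α = u' + m' • α → False := by
    intro u u' m m' hu hu' h1 h4 hlt he
    refine h.mid u' hu' (m' - m + (r - 1)) (by omega) (by omega) ?_
    have hb := h.bot u hu
    rwa [eq_add_sub_zsmul he, add_assoc, ← add_zsmul] at hb
  rcases lt_trichotomy m m' with hlt | heq | hlt
  · exact (key hu hu' h1 h4 hlt he).elim
  · exact heq
  · exact (key hu' hu h3 h2 hlt he.symm).elim

/-- Translate the fibre coordinates of `γ` at the times `r, …, s` by `τ`. -/
def perturb (R : Torus ≃ₜ Torus) (α : Circ) (r s : ℤ) (τ γ : C(Circ, Circ)) : C(Circ, Circ) :=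
  shiftRange R α τ γ r (s - r + 1).toNat

/-- Uniformity in `γ₁` serves when two perturbations follow each other and the size of the second is
fixed before the first is made. -/
theorem IsSkew.exists_perturb_mem_nhds (hR : IsSkew R α) (r s : ℤ) {γ : C(Circ, Circ)}
    {W : Set C(Circ, Circ)} (hW : W ∈ 𝓝 γ) :
    ∃ δ > 0, ∃ W₁ ∈ 𝓝 γ, ∀ γ₁ ∈ W₁, ∀ τ : C(Circ, Circ), (∀ x, ‖τ x‖ < δ) →
      perturb R α r s τ γ₁ ∈ W := by
  have hc : Continuous fun p : C(Circ, Circ) × C(Circ, Circ) => perturb R α r s p.1 p.2 :=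
    continuous_shiftRange r _
  have h0 : perturb R α r s 0 γ = γ := hR.shiftRange_zero γ r _
  have : ∀ᶠ p in 𝓝 ((0 : C(Circ, Circ)), γ), perturb R α r s p.1 p.2 ∈ W :=
    hc.continuousAt.eventually (by simp only [h0]; exact hW)
  rw [nhds_prod_eq] at this
  obtain ⟨P, hP, Q, hQ, h⟩ := Filter.eventually_prod_iff.1 this
  obtain ⟨δ, hδ, hP⟩ := Metric.eventually_nhds_iff.1 hP
  refine ⟨δ, hδ, {γ₁ | Q γ₁}, hQ, fun γ₁ hγ₁ τ hτ => h (hP ?_) hγ₁⟩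
  rw [dist_zero_right]
  exact (ContinuousMap.norm_lt_iff _ hδ).2 hτ

theorem IsSkew.exists_perturb_mem (hR : IsSkew R α) (r s : ℤ) {γ : C(Circ, Circ)}
    {W : Set C(Circ, Circ)} (hW : W ∈ 𝓝 γ) :
    ∃ δ > 0, ∀ τ : C(Circ, Circ), (∀ x, ‖τ x‖ < δ) → perturb R α r s τ γ ∈ W := by
  obtain ⟨δ, hδ, W₁, hW₁, h⟩ := hR.exists_perturb_mem_nhds r s hW
  exact ⟨δ, hδ, h γ (mem_of_mem_nhds hW₁)⟩

theorem coord_congr {γ γ' : C(Circ, Circ)} {k : ℤ} {θ : Circ}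
    (h : γ' (θ + k • α) = γ (θ + k • α)) : coord R α γ' k θ = coord R α γ k θ := by
  rw [coord, coord, h]

theorem IsSkew.perturb_apply_of_notMem (hR : IsSkew R α) {τ γ : C(Circ, Circ)}
    (hτ : ∀ x ∉ J, τ x = 0) {θ : Circ} (h : ∀ u ∈ J, ∀ m, r ≤ m → m ≤ s → θ ≠ u + m • α) :
    perturb R α r s τ γ θ = γ θ := by
  refine hR.shiftRange_apply_of_eq_zero fun m h1 h2 => hτ _ fun hm => ?_
  exact h _ hm m h1 (by omega) (by rw [sub_add_cancel])

theorem IsBox.coord_perturb (h : IsBox α V J r s) (hR : IsSkew R α) {τ γ : C(Circ, Circ)}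
    (hτ : ∀ x ∉ J, τ x = 0) {u : Circ} (hu : u ∈ J) {k : ℤ} (h1 : r ≤ k) (h2 : k ≤ s) :
    coord R α (perturb R α r s τ γ) k u = coord R α γ k u + τ u := by
  rw [hR.coord_eq_iff_apply]
  refine hR.shiftRange_apply h1 (by omega) fun m h3 h4 hmk => hτ _ fun hm => hmk ?_
  exact h.eq_of_add_eq hm hu h3 (by omega) h1 h2 (by rw [sub_add_cancel])

/-- If one of the two times falls in the tower over `J`, the other, not being separated from it,
lies in the same block and both values move by the same `τ u`. If neither does, nothing moves. -/
theorem IsBox.coherent_perturb (h : IsBox α V J r s) (hR : IsSkew R α) {τ γ : C(Circ, Circ)}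
    (hτ : ∀ x ∉ J, τ x = 0) : Coherent R α V γ (perturb R α r s τ γ) := by
  have key : ∀ θ i j, ¬ Separated α V θ i j →
      (∃ u ∈ J, ∃ m, r ≤ m ∧ m ≤ s ∧ θ + i • α = u + m • α) →
      (θ ∈ coincidence R α (perturb R α r s τ γ) i j ↔ θ ∈ coincidence R α γ i j) := by
    rintro θ i j hs ⟨u, hu, m, h1, h2, he⟩
    obtain rfl := eq_add_sub_zsmul he
    rw [separated_add] at hs
    rw [hR.mem_coincidence_add, hR.mem_coincidence_add]
    rw [add_sub_cancel] at hs ⊢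
    have h3 : ¬ (j + (m - i) < r ∨ s < j + (m - i)) := fun hl => hs (h.separated hu h1 h2 hl)
    change coord R α _ _ _ = coord R α _ _ _ ↔ coord R α _ _ _ = coord R α _ _ _
    rw [h.coord_perturb hR hτ hu h1 h2, h.coord_perturb hR hτ hu (by omega) (by omega),
      add_left_inj]
  intro θ i j hs
  by_cases hi : ∃ u ∈ J, ∃ m, r ≤ m ∧ m ≤ s ∧ θ + i • α = u + m • α
  · exact key θ i j hs hi
  by_cases hj : ∃ u ∈ J, ∃ m, r ≤ m ∧ m ≤ s ∧ θ + j • α = u + m • α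
  · rw [coincidence_comm _ i, coincidence_comm _ i]
    exact key θ j i (fun h' => hs h'.symm) hj
  push Not at hi hj
  change coord R α _ _ _ = coord R α _ _ _ ↔ coord R α _ _ _ = coord R α _ _ _
  rw [coord_congr (hR.perturb_apply_of_notMem hτ fun u hu m h1 h2 => hi u hu m h1 h2),
    coord_congr (hR.perturb_apply_of_notMem hτ fun u hu m h1 h2 => hj u hu m h1 h2)]

end

section

/-! ### Return times and boxes -/

variable {R : Torus ≃ₜ Torus} {α : Circ} {V J : Set Circ} {r s : ℤ}

theorem zsmul_ne_zero_of_denseRange (hα : DenseRange fun k : ℤ => k • α) {n : ℤ} (hn : n ≠ 0) :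
    n • α ≠ 0 := by
  rw [AddCircle.denseRange_zsmul_iff] at hα
  have hα' : ¬ IsOfFinAddOrder α := by simpa [addOrderOf_eq_zero_iff] using hα
  intro h
  exact hn (injective_zsmul_iff_not_isOfFinAddOrder.2 hα' (by simpa using h))

theorem zsmul_injective_of_denseRange (hα : DenseRange fun k : ℤ => k • α) {k l : ℤ}
    (h : k • α = l • α) : k = l := by
  by_contra hne
  exact zsmul_ne_zero_of_denseRange hα (sub_ne_zero.2 hne) (by rw [sub_zsmul, h, add_neg_cancel])

/-- The orbits of a minimal rotation visit a given neighbourhood with bounded gaps. -/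
theorem exists_visit_bound (hα : DenseRange fun k : ℤ => k • α) (hV : V ∈ 𝓝 (0 : Circ)) :
    ∃ L : ℕ, ∀ θ : Circ, (∃ n : ℕ, n ≤ L ∧ θ + (n : ℤ) • α ∈ V) ∧
      ∃ n : ℕ, n + 1 ≤ L ∧ θ + (-n - 1 : ℤ) • α ∈ V := by
  have hcov : (univ : Set Circ) ⊆ ⋃ k : ℤ, {θ | θ + k • α ∈ interior V} := by
    intro θ _
    have ho : IsOpen {x : Circ | θ + x ∈ interior V} :=
      isOpen_interior.preimage (continuous_const.add continuous_id)
    obtain ⟨k, hk⟩ := hα.exists_mem_open ho ⟨-θ, by simpa using mem_interior_iff_mem_nhds.2 hV⟩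
    exact mem_iUnion.2 ⟨k, hk⟩
  obtain ⟨t, ht⟩ := isCompact_univ.elim_finite_subcover _ (fun k : ℤ =>
    isOpen_interior.preimage (continuous_id.add continuous_const)) hcov
  set K : ℕ := t.sup Int.natAbs with hK
  have hvis : ∀ θ : Circ, ∃ k : ℤ, k.natAbs ≤ K ∧ θ + k • α ∈ V := by
    intro θ
    obtain ⟨k, hk, hθ⟩ := mem_iUnion₂.1 (ht (mem_univ θ))
    exact ⟨k, Finset.le_sup (f := Int.natAbs) hk, interior_subset hθ⟩
  refine ⟨2 * K + 1, fun θ => ⟨?_, ?_⟩⟩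
  · obtain ⟨k, hk, h⟩ := hvis (θ + (K : ℤ) • α)
    rw [add_assoc, ← add_zsmul] at h
    refine ⟨(K + k).toNat, by omega, ?_⟩
    rwa [Int.toNat_of_nonneg (by omega)]
  · obtain ⟨k, hk, h⟩ := hvis (θ + (-K - 1 : ℤ) • α)
    rw [add_assoc, ← add_zsmul] at h
    refine ⟨(K - k).toNat, by omega, ?_⟩
    rw [Int.toNat_of_nonneg (by omega)]
    convert h using 3
    ring

/-- Points visiting `V` at the same times as `θ` share a box. -/
theorem exists_isBox_of_visits {L : ℕ} {θ : Circ} (h1 : ∃ n : ℕ, n ≤ L ∧ θ + (n : ℤ) • α ∈ V)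
    (h2 : ∃ n : ℕ, n + 1 ≤ L ∧ θ + (-n - 1 : ℤ) • α ∈ V) :
    ∃ r s : ℤ, -L ≤ r ∧ s ≤ L ∧ ∀ J : Set Circ,
      (∀ u ∈ J, ∀ m : ℤ, -L ≤ m → m ≤ L → (u + m • α ∈ V ↔ θ + m • α ∈ V)) → IsBox α V J r s := by
  classical
  have e1 : ∃ n : ℕ, θ + (n : ℤ) • α ∈ V := h1.imp fun _ h => h.2
  have e2 : ∃ n : ℕ, θ + (-n - 1 : ℤ) • α ∈ V := h2.imp fun _ h => h.2
  have b1 : Nat.find e1 ≤ L := by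
    obtain ⟨n, hn, hnV⟩ := h1
    exact (Nat.find_min' e1 hnV).trans hn
  have b2 : Nat.find e2 + 1 ≤ L := by
    obtain ⟨n, hn, hnV⟩ := h2
    exact (Nat.succ_le_succ (Nat.find_min' e2 hnV)).trans hn
  -- The block starts just after the last visit at a negative time and ends at the first visit at a
  -- non-negative time.
  refine ⟨-(Nat.find e2 : ℤ), Nat.find e1, by omega, by omega, fun J hJ =>
      ⟨by omega, by omega, ?_, ?_, ?_⟩⟩
  · intro u hu
    exact (hJ u hu _ (by omega) (by omega)).2 (Nat.find_spec e2)
  · intro u hu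
    exact (hJ u hu _ (by omega) (by omega)).2 (Nat.find_spec e1)
  · intro u hu m hm1 hm2 hm
    have hm' := (hJ u hu m (by omega) (by omega)).1 hm
    rcases le_or_gt 0 m with h0 | h0
    · refine Nat.find_min e1 (m := m.toNat) (by omega) ?_
      rwa [Int.toNat_of_nonneg h0]
    · refine Nat.find_min e2 (m := (-m - 1).toNat) (by omega) ?_
      rw [Int.toNat_of_nonneg (by omega)]
      convert hm' using 3
      ring

theorem eventually_mem_iff_of_notMem_frontier {x : Circ} (h : x ∉ frontier V) :
    ∀ᶠ y in 𝓝 x, (y ∈ V ↔ x ∈ V) := by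
  by_cases hx : x ∈ V
  · have hi : x ∈ interior V := by
      by_contra hi
      exact h ⟨subset_closure hx, hi⟩
    filter_upwards [mem_interior_iff_mem_nhds.1 hi] with y hy
    exact iff_of_true hy hx
  · have hc : x ∉ closure V := fun hc => h ⟨hc, fun hi => hx (interior_subset hi)⟩
    filter_upwards [isClosed_closure.isOpen_compl.mem_nhds hc] with y hy
    exact iff_of_false (fun hyV => hy (subset_closure hyV)) hx

/-- Away from the frontier of `V`, the finite pattern of visits is locally constant. -/
theorem exists_isBox_nhds {L : ℕ} {θ : Circ} (h1 : ∃ n : ℕ, n ≤ L ∧ θ + (n : ℤ) • α ∈ V)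
    (h2 : ∃ n : ℕ, n + 1 ≤ L ∧ θ + (-n - 1 : ℤ) • α ∈ V)
    (hfr : ∀ m : ℤ, -L ≤ m → m ≤ L → θ + m • α ∉ frontier V) :
    ∃ r s : ℤ, ∃ J ∈ 𝓝 θ, IsBox α V J r s := by
  obtain ⟨r, s, -, -, hbox⟩ := exists_isBox_of_visits h1 h2
  have hev : ∀ᶠ u in 𝓝 θ, ∀ m ∈ Finset.Icc (-L : ℤ) L, (u + m • α ∈ V ↔ θ + m • α ∈ V) := by
    refine (Filter.eventually_all_finset _).2 fun m hm => ?_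
    rw [Finset.mem_Icc] at hm
    have hc : Continuous fun u : Circ => u + m • α := continuous_id.add continuous_const
    exact hc.continuousAt.eventually (eventually_mem_iff_of_notMem_frontier (hfr m hm.1 hm.2))
  exact ⟨r, s, _, hev, hbox _ fun u hu m h1 h2 => hu m (Finset.mem_Icc.2 ⟨h1, h2⟩)⟩

theorem exists_isBox_of_isPreconnected {L : ℕ} (hJ : IsPreconnected J)
    (hvis : ∀ θ : Circ, (∃ n : ℕ, n ≤ L ∧ θ + (n : ℤ) • α ∈ V) ∧
      ∃ n : ℕ, n + 1 ≤ L ∧ θ + (-n - 1 : ℤ) • α ∈ V)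
    (hfr : ∀ u ∈ J, ∀ m : ℤ, -L ≤ m → m ≤ L → u + m • α ∉ frontier V) :
    ∃ r s : ℤ, -L ≤ r ∧ s ≤ L ∧ IsBox α V J r s := by
  rcases J.eq_empty_or_nonempty with rfl | ⟨θ, hθ⟩
  · exact ⟨0, 0, by omega, by omega, by simp, by simp, by simp, by simp, by simp⟩
  obtain ⟨r, s, hr, hs, hbox⟩ := exists_isBox_of_visits (hvis θ).1 (hvis θ).2
  refine ⟨r, s, hr, hs, hbox J fun u hu m h1 h2 => ?_⟩
  have key : ∀ x ∈ J, ∀ y ∈ J, x + m • α ∈ V → y + m • α ∈ V := by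
    intro x hx y hy hxV
    by_contra hyV
    have hc : Continuous fun u : Circ => u + m • α := continuous_id.add continuous_const
    have hcov : ∀ z ∈ J, z + m • α ∈ interior V ∨ z + m • α ∈ (closure V)ᶜ := fun z hz => by
      by_contra! h
      exact hfr z hz m h1 h2 ⟨not_not.1 h.2, h.1⟩
    obtain ⟨z, -, hz1, hz2⟩ := hJ {z | z + m • α ∈ interior V} {z | z + m • α ∈ (closure V)ᶜ}
      (isOpen_interior.preimage hc) (isClosed_closure.isOpen_compl.preimage hc) hcov
      ⟨x, hx, (hcov x hx).resolve_right fun h => h (subset_closure hxV)⟩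
      ⟨y, hy, (hcov y hy).resolve_left fun h => hyV (interior_subset h)⟩
    exact hz2 (subset_closure (interior_subset hz1))
  exact ⟨key u hu θ hθ, key θ hθ u hu⟩

/-! ### Bump functions -/

theorem exists_bump {θ : Circ} {J : Set Circ} (hJ : J ∈ 𝓝 θ) :
    ∃ φ : C(Circ, ℝ), (∀ᶠ x in 𝓝 θ, φ x = 1) ∧ (∀ x, 0 ≤ φ x ∧ φ x ≤ 1) ∧ ∀ x ∉ J, φ x = 0 := by
  obtain ⟨ρ, hρ, hball⟩ := Metric.mem_nhds_iff.1 hJ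
  refine ⟨⟨fun x => max 0 (min 1 (2 - 2 * dist x θ / ρ)), by fun_prop⟩, ?_, fun x => ⟨?_, ?_⟩,
      fun x hx => ?_⟩
  · filter_upwards [Metric.ball_mem_nhds θ (half_pos hρ)] with x hx
    rw [Metric.mem_ball] at hx
    have : 2 * dist x θ / ρ ≤ 1 := by rw [div_le_one hρ]; linarith
    rw [ContinuousMap.coe_mk, min_eq_left (by linarith), max_eq_right zero_le_one]
  · exact le_max_left _ _
  · exact max_le zero_le_one (min_le_left _ _)
  · have h1 : ρ ≤ dist x θ := not_lt.1 fun h => hx (hball h)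
    have : 2 ≤ 2 * dist x θ / ρ := by rw [le_div_iff₀ hρ]; linarith
    exact max_eq_left ((min_le_right _ _).trans (by linarith))

/-! ### Separating the graph along an orbit -/

/-- No coincidence over the point `0` between two times of `S` that are separated by `V`. -/
def DistinctOn (R : Torus ≃ₜ Torus) (α : Circ) (V : Set Circ) (γ : C(Circ, Circ)) (S : Set ℤ) :
    Prop :=
  ∀ k ∈ S, ∀ l ∈ S, Separated α V 0 k l → (0 : Circ) ∉ coincidence R α γ k l

theorem DistinctOn.eventually {S : Set ℤ} (hS : S.Finite) {γ : C(Circ, Circ)}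
    (h : DistinctOn R α V γ S) : ∀ᶠ γ' in 𝓝 γ, DistinctOn R α V γ' S := by
  refine hS.eventually_all.2 fun k hk => hS.eventually_all.2 fun l hl => ?_
  by_cases hs : Separated α V 0 k l
  · have ho := isOpen_setOf_disjoint_coincidence (R := R) (α := α)
        (isCompact_singleton (x := (0 : Circ))) k l
    filter_upwards [ho.mem_nhds (x := γ)
        (fun θ hθ => by rw [hθ]; exact h k hk l hl hs)] with γ' hγ' _
    exact hγ' 0 rfl
  · exact Eventually.of_forall fun _ h => absurd h hs

theorem DistinctOn.notMem_coincidence {S : Set ℤ} {γ : C(Circ, Circ)} (hR : IsSkew R α)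
    (h : DistinctOn R α V γ S) {k n : ℤ} (hk : k ∈ S) (hn : n + k ∈ S)
    (hs : Separated α V (k • α) 0 n) : k • α ∉ coincidence R α γ 0 n := by
  rw [← zero_add (k • α)] at hs ⊢
  rw [separated_add, zero_add] at hs
  rw [hR.mem_coincidence_add, zero_add]
  exact h k hk _ hn hs

/-- A bump translation by a constant `t` along the box of `k • α` moves the value at time `k` and
leaves those at separated times of `S` fixed; finitely many values of `t` must be avoided. -/
theorem DistinctOn.exists_insert (hR : IsSkew R α) (hα : DenseRange fun k : ℤ => k • α)
    {S : Set ℤ} (hS : S.Finite) {γ : C(Circ, Circ)} (h : DistinctOn R α V γ S) {k : ℤ}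
    (hJ : J ∈ 𝓝 (k • α)) (hbox : IsBox α V J r s) {W : Set C(Circ, Circ)} (hW : W ∈ 𝓝 γ) :
    ∃ γ' ∈ W, Coherent R α V γ γ' ∧ DistinctOn R α V γ' (insert k S) := by
  -- Removing these orbit points keeps the perturbation off the times of `S`, except those with `l -
  -- m = k`, which lie in the block of `k` and are not separated from it.
  set J' : Set Circ := J ∩ {u | ∀ l ∈ S, ∀ m ∈ Finset.Icc r s, l - m ≠ k → u ≠ (l - m) • α} with hJ'
  have hJ'n : J' ∈ 𝓝 (k • α) := by
    refine inter_mem hJ (hS.eventually_all.2 fun l _ =>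
        (Filter.eventually_all_finset _).2 fun m _ => ?_)
    by_cases hlm : l - m = k
    · exact Eventually.of_forall fun _ h => absurd hlm h
    · filter_upwards [isOpen_ne.mem_nhds fun h : k • α = (l - m) • α =>
        hlm (zsmul_injective_of_denseRange hα h).symm] with u hu _ using hu
  have hbox' : IsBox α V J' r s := hbox.mono inter_subset_left
  obtain ⟨φ, hφ1, hφ, hφ0⟩ := exists_bump hJ'n
  obtain ⟨δ, hδ, hpert⟩ := hR.exists_perturb_mem r s (inter_mem hW (h.eventually hS))
  obtain ⟨t, ht, htne⟩ : ∃ t : ℝ, |t| < δ ∧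
      ∀ l ∈ S, (t : Circ) ≠ coord R α γ (l - k) (k • α) - coord R α γ 0 (k • α) := by
    have h1 : ∀ᶠ t : ℝ in 𝓝[≠] 0, |t| < δ := by
      refine nhdsWithin_le_nhds ?_
      filter_upwards [Metric.ball_mem_nhds 0 hδ] with t ht
      simpa using ht
    exact (h1.and (hS.eventually_all.2 fun l _ => eventually_coe_ne 0 _)).exists
  set τ : C(Circ, Circ) := ⟨fun x => ((t * φ x : ℝ) : Circ), continuous_coe.comp
      (by fun_prop)⟩ with hτ
  have hτ0 : ∀ x ∉ J', τ x = 0 := fun x hx => by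
    simp [hτ, hφ0 x hx]
  have hmem := hpert τ fun x => by
    refine (norm_coe_le_abs _).trans_lt (lt_of_le_of_lt ?_ ht)
    rw [abs_mul, abs_of_nonneg (hφ x).1]
    exact mul_le_of_le_one_right (abs_nonneg t) (hφ x).2
  refine ⟨_, hmem.1, hbox'.coherent_perturb hR hτ0, ?_⟩
  have hkJ' : k • α ∈ J' := mem_of_mem_nhds hJ'n
  have key : ∀ l ∈ S, Separated α V 0 k l →
      (0 : Circ) ∉ coincidence R α (perturb R α r s τ γ) k l := by
    intro l hl hs
    have hs' : Separated α V (k • α) 0 (l - k) := by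
      rw [← zero_add (k • α), separated_add]
      simpa using hs
    have hnc : ¬ (r ≤ l - k ∧ l - k ≤ s) := fun hc =>
      hbox'.not_separated hkJ' hbox.nonpos hbox.nonneg hc.1 hc.2 hs'
    have hval : perturb R α r s τ γ (k • α + (l - k) • α) = γ (k • α + (l - k) • α) := by
      refine hR.perturb_apply_of_notMem hτ0 fun u hu m h1 h2 he => ?_
      rw [← add_zsmul, add_sub_cancel] at he
      have hu' : u = (l - m) • α := by
        rw [sub_zsmul, ← sub_eq_add_neg, he, add_sub_cancel_right]
      by_cases hlm : l - m = k
      · exact hnc (by omega)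
      · exact hu.2 l hl m (Finset.mem_Icc.2 ⟨h1, h2⟩) hlm hu'
    have h0 : (0 : Circ) ∈ coincidence R α (perturb R α r s τ γ) k l ↔
        k • α ∈ coincidence R α (perturb R α r s τ γ) 0 (l - k) := by
      rw [← zero_add (k • α), hR.mem_coincidence_add]
      simp
    rw [h0]
    change ¬ coord R α _ _ _ = coord R α _ _ _
    rw [hbox'.coord_perturb hR hτ0 hkJ' hbox.nonpos hbox.nonneg, coord_congr hval]
    intro he
    refine htne l hl ?_
    rw [← he, hτ, ContinuousMap.coe_mk, hφ1.self_of_nhds, mul_one, add_sub_cancel_left]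
  rintro i (rfl | hi) j (rfl | hj) hs
  · obtain ⟨m, hm, -⟩ := hs
    omega
  · exact key j hj hs
  · rw [coincidence_comm]
    exact key i hi hs.symm
  · exact hmem.2 i hi j hj hs

theorem DistinctOn.exists_union (hR : IsSkew R α) (hα : DenseRange fun k : ℤ => k • α)
    {S : Set ℤ} (hS : S.Finite) {γ : C(Circ, Circ)} (h : DistinctOn R α V γ S)
    (hbox : ∀ k ∉ S, ∃ r s : ℤ, ∃ J ∈ 𝓝 (k • α), IsBox α V J r s) (T : Finset ℤ)
    {W : Set C(Circ, Circ)} (hW : W ∈ 𝓝 γ) :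
    ∃ γ' ∈ W, Coherent R α V γ γ' ∧ DistinctOn R α V γ' (S ∪ T) := by
  classical
  obtain ⟨W', hW'W, hW'o, hγW'⟩ := mem_nhds_iff.1 hW
  suffices h' : ∃ γ' ∈ W', Coherent R α V γ γ' ∧ DistinctOn R α V γ' (S ∪ T) by
    obtain ⟨γ', h1, h2⟩ := h'
    exact ⟨γ', hW'W h1, h2⟩
  induction T using Finset.induction_on with
  | empty => exact ⟨γ, hγW', Coherent.refl γ, by simpa using h⟩
  | insert k T _ ih =>
    obtain ⟨γ₁, hγ₁, hc₁, hd₁⟩ := ih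
    rw [Finset.coe_insert, union_insert]
    by_cases hk : k ∈ S
    · rw [insert_eq_of_mem (mem_union_left _ hk)]
      exact ⟨γ₁, hγ₁, hc₁, hd₁⟩
    · obtain ⟨r, s, J, hJ, hb⟩ := hbox k hk
      obtain ⟨γ₂, hγ₂, hc₂, hd₂⟩ := hd₁.exists_insert hR hα (hS.union T.finite_toSet) hJ hb
        (hW'o.mem_nhds hγ₁)
      exact ⟨γ₂, hγ₂, hc₁.trans hc₂, hd₂⟩

end

section

variable {R : Torus ≃ₜ Torus} {α : Circ} {V : Set Circ} {r s : ℤ}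

/-! ### Making the coincidences between separated times flat -/

theorem exists_le_norm_zsmul (hα : DenseRange fun k : ℤ => k • α) (B : ℕ) :
    ∃ c : ℝ, 0 < c ∧ c ≤ 1 ∧ ∀ n : ℤ, n ≠ 0 → |n| ≤ B → c ≤ ‖n • α‖ := by
  have h : ∀ n ∈ Finset.Icc (-B : ℤ) B, ∀ᶠ c : ℝ in 𝓝[>] 0, n ≠ 0 → c ≤ ‖n • α‖ := by
    intro n _
    by_cases hn : n = 0
    · exact Eventually.of_forall fun _ h => absurd hn h
    · have : 0 < ‖n • α‖ := norm_pos_iff.2 (zsmul_ne_zero_of_denseRange hα hn)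
      filter_upwards [nhdsWithin_le_nhds (Iic_mem_nhds this)] with c hc _ using hc
  obtain ⟨c, ⟨h1, h2⟩, h3⟩ := (((Filter.eventually_all_finset _).2 h).and
    (nhdsWithin_le_nhds (Iic_mem_nhds zero_lt_one))).and self_mem_nhdsWithin |>.exists
  exact ⟨c, h3, h2, fun n hn hnB => h1 n (Finset.mem_Icc.2 (abs_le.1 hnB)) hn⟩

/-- The complement of a finite set of the circle is a finite union of arcs between its points. -/
theorem exists_arcs {G : Set Circ} (hG : G.Finite) (h0 : (0 : Circ) ∈ G) :
    ∃ A : Finset (ℝ × ℝ), (∀ p ∈ A, p.1 < p.2 ∧ (p.1 : Circ) ∈ G ∧ (p.2 : Circ) ∈ G ∧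
      ∀ t ∈ Ioo p.1 p.2, (t : Circ) ∉ G) ∧
      ∀ θ ∉ G, ∃ p ∈ A, θ ∈ ((↑) : ℝ → Circ) '' Ioo p.1 p.2 := by
  classical
  -- Both `0` and `1` belong to `H`, so each remaining parameter lies strictly between two
  -- consecutive elements.
  set H : Set ℝ := {t | t ∈ Icc (0 : ℝ) 1 ∧ (t : Circ) ∈ G} with hH
  have hinj : InjOn ((↑) : ℝ → Circ) (Ico (0 : ℝ) 1) := by
    intro x hx y hy hxy
    exact (AddCircle.coe_eq_coe_iff_of_mem_Ico (p := 1) (a := 0) (by simpa using hx)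
      (by simpa using hy)).1 hxy
  have hHf : H.Finite := by
    have h1 : (Ico (0 : ℝ) 1 ∩ ((↑) : ℝ → Circ) ⁻¹' G).Finite := by
      refine Finite.of_finite_image (hG.subset ?_) (hinj.mono inter_subset_left)
      rintro _ ⟨t, ht, rfl⟩
      exact ht.2
    refine (h1.union (finite_singleton 1)).subset ?_
    rintro t ⟨ht, htG⟩
    rcases ht.2.eq_or_lt with h | h
    · exact Or.inr h
    · exact Or.inl ⟨⟨ht.1, h⟩, htG⟩
  have hH0 : (0 : ℝ) ∈ hHf.toFinset := by
    rw [Finite.mem_toFinset]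
    exact ⟨⟨le_rfl, zero_le_one⟩, by simpa using h0⟩
  have hH1 : (1 : ℝ) ∈ hHf.toFinset := by
    rw [Finite.mem_toFinset]
    refine ⟨⟨zero_le_one, le_rfl⟩, ?_⟩
    rw [AddCircle.coe_period]
    exact h0
  refine ⟨(hHf.toFinset ×ˢ hHf.toFinset).filter fun p => p.1 < p.2 ∧ ∀ t ∈ Ioo p.1 p.2,
      (t : Circ) ∉ G,
    ?_, ?_⟩
  · intro p hp
    rw [Finset.mem_filter, Finset.mem_product, Finite.mem_toFinset, Finite.mem_toFinset] at hp
    exact ⟨hp.2.1, hp.1.1.2, hp.1.2.2, hp.2.2⟩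
  · intro θ hθ
    obtain ⟨t, ht, rfl⟩ : θ ∈ ((↑) : ℝ → Circ) '' Ico 0 (0 + 1) := by
      rw [AddCircle.coe_image_Ico_eq]
      trivial
    rw [zero_add] at ht
    have hne : ∀ x ∈ hHf.toFinset, x ≠ t := by
      rintro x hx rfl
      rw [Finite.mem_toFinset] at hx
      exact hθ hx.2
    have n1 : (hHf.toFinset.filter (· ≤ t)).Nonempty := ⟨0, by simp [hH0, ht.1]⟩
    have n2 : (hHf.toFinset.filter (t ≤ ·)).Nonempty := ⟨1, by simp [hH1, ht.2.le]⟩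
    have m1 := Finset.max'_mem _ n1
    have m2 := Finset.min'_mem _ n2
    have u1 := fun x hx => Finset.le_max' (hHf.toFinset.filter (· ≤ t)) x hx
    have u2 := fun x hx => Finset.min'_le (hHf.toFinset.filter (t ≤ ·)) x hx
    set a := (hHf.toFinset.filter (· ≤ t)).max' n1
    set b := (hHf.toFinset.filter (t ≤ ·)).min' n2
    rw [Finset.mem_filter] at m1 m2
    have hat : a < t := lt_of_le_of_ne m1.2 (hne a m1.1)
    have htb : t < b := lt_of_le_of_ne m2.2 (hne b m2.1).symm
    refine ⟨(a, b), ?_, ⟨t, ⟨hat, htb⟩, rfl⟩⟩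
    rw [Finset.mem_filter, Finset.mem_product]
    refine ⟨⟨m1.1, m2.1⟩, hat.trans htb, fun x hx hxG => ?_⟩
    have hxH : x ∈ hHf.toFinset := by
      rw [Finite.mem_toFinset]
      have ha := (hHf.mem_toFinset.1 m1.1).1.1
      have hb := (hHf.mem_toFinset.1 m2.1).1.2
      exact ⟨⟨ha.trans hx.1.le, hx.2.le.trans hb⟩, hxG⟩
    rcases le_total x t with h | h
    · exact absurd (u1 x (Finset.mem_filter.2 ⟨hxH, h⟩)) (not_le.2 hx.1)
    · exact absurd (u2 x (Finset.mem_filter.2 ⟨hxH, h⟩)) (not_le.2 hx.2)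

/-- One step of the flattening: make the coincidences involving an orbit segment of an arc flat. -/
theorem exists_flat_over_arc (hR : IsSkew R α) (hV : IsClosed V) {a b : ℝ} (hab : a < b)
    (hab1 : b < a + 1) {L₀ L N : ℕ} {M : ℕ}
    (ha : ∃ c : ℤ, |c| ≤ M ∧ (a : Circ) = c • α) (hb : ∃ c : ℤ, |c| ≤ M ∧ (b : Circ) = c • α)
    (hbox : IsBox α V (((↑) : ℝ → Circ) '' Ioo a b) r s) (hr : -L₀ ≤ r) (hs : s ≤ L₀)
    (hdisj : ∀ u ∈ ((↑) : ℝ → Circ) '' Ioo a b, ∀ u' ∈ ((↑) : ℝ → Circ) '' Ioo a b,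
      ∀ n : ℤ, n ≠ 0 → |n| ≤ 2 * L₀ + L → u ≠ u' + n • α)
    (hN : M + L₀ + L ≤ N) {γ : C(Circ, Circ)} (hγ : DistinctOn R α V γ (Icc (-N : ℤ) N))
    {W : Set C(Circ, Circ)} (hW : W ∈ 𝓝 γ) :
    ∃ γ' ∈ W, Coherent R α V γ γ' ∧ DistinctOn R α V γ' (Icc (-N : ℤ) N) ∧
      ∀ (θ : Circ) (n : ℤ), |n| ≤ L → Separated α V θ 0 n →
        (θ ∈ ((↑) : ℝ → Circ) '' Ioo a b ∨ FlatAt (coincidence R α γ 0 n) θ) →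
          FlatAt (coincidence R α γ' 0 n) θ := by
  classical
  set J : Set Circ := ((↑) : ℝ → Circ) '' Ioo a b with hJ
  set J' : Set Circ := ((↑) : ℝ → Circ) '' Icc a b with hJ'
  have hJ'c : IsClosed J' := (isCompact_Icc.image continuous_coe).isClosed
  have hJJ' : J ⊆ J' := image_mono Ioo_subset_Icc_self
  have hJ'cl : J' ⊆ closure J := by
    rw [hJ', ← closure_Ioo hab.ne]
    exact image_closure_subset_closure_image continuous_coe
  have hend : ∀ e ∈ J', e ∉ J → ∃ c : ℤ, |c| ≤ M ∧ e = c • α := by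
    rintro _ ⟨t, ht, rfl⟩ he
    rcases ht.1.eq_or_lt with rfl | h1
    · exact ha
    rcases ht.2.eq_or_lt with rfl | h2
    · exact hb
    · exact absurd ⟨t, ⟨h1, h2⟩, rfl⟩ he
  have hclV : ∀ m : ℤ, (∀ u ∈ J, u + m • α ∈ V) → ∀ u ∈ J', u + m • α ∈ V := by
    intro m h u hu
    have hc : Continuous fun u : Circ => u + m • α := continuous_id.add continuous_const
    exact closure_minimal (t := (fun u : Circ => u + m • α) ⁻¹' V) h (hV.preimage hc) (hJ'cl hu)
  have hsep' : ∀ u ∈ J', ∀ k l : ℤ, r ≤ k → k ≤ s → (l < r ∨ s < l) → Separated α V u k l := by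
    rintro u hu k l h1 h2 (hl | hl)
    · exact ⟨r - 1, by omega, hclV _ hbox.bot u hu⟩
    · exact ⟨s, by omega, hclV _ hbox.top u hu⟩
  -- Pairs of a time in the block and a time outside it. The block lies in `[-L₀, L₀]` and
  -- differences are at most `L`, whence the bound `L₀ + L`.
  set D : Finset (ℤ × ℤ) := ((Finset.Icc r s) ×ˢ (Finset.Icc (-(L₀ + L : ℤ)) (L₀ + L))).filter
    fun p => p.2 < r ∨ s < p.2 with hD
  have hDmem : ∀ p : ℤ × ℤ, p ∈ D ↔ (r ≤ p.1 ∧ p.1 ≤ s) ∧ (-(L₀ + L : ℤ) ≤ p.2 ∧ p.2 ≤ L₀ + L) ∧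
      (p.2 < r ∨ s < p.2) := fun p => by
    rw [hD, Finset.mem_filter, Finset.mem_product, Finset.mem_Icc, Finset.mem_Icc, and_assoc]
  -- Over the arc only the value at the block time moves, by `τ`; a coincidence becomes the equation
  -- `τ = d p`.
  set d : D → ℝ → Circ := fun p t => coord R α γ p.1.2 (t : Circ) - coord R α γ p.1.1
      (t : Circ) with hd
  have hdc : ∀ p, Continuous (d p) := fun p =>
    ((continuous_coord R α γ _).comp continuous_coe).sub
        ((continuous_coord R α γ _).comp continuous_coe)
  -- Endpoints of the arc are on the orbit of `0`, where separated times are already distinct; hence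
  -- the level `0` is free there.
  have hdne : ∀ p : D, ∀ t : ℝ, (t : Circ) ∈ J' → (∃ c : ℤ, |c| ≤ M ∧ (t : Circ) = c • α) →
      d p t ≠ 0 := by
    rintro ⟨p, hp⟩ t ht ⟨c, hc, htc⟩ h0
    rw [hDmem] at hp
    rw [abs_le] at hc
    have hs1 := hsep' _ ht p.1 p.2 hp.1.1 hp.1.2 hp.2.2
    have hco : (t : Circ) ∈ coincidence R α γ p.1 p.2 := (sub_eq_zero.1 h0).symm
    rw [htc, ← zero_add (c • α)] at hs1 hco
    rw [separated_add] at hs1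
    rw [hR.mem_coincidence_add] at hco
    exact hγ _ (mem_Icc.2 (by omega)) _ (mem_Icc.2 (by omega)) hs1 hco
  obtain ⟨δ, hδ, hpert⟩ := hR.exists_perturb_mem r s
    (inter_mem hW (hγ.eventually (finite_Icc (-N : ℤ) N)))
  obtain ⟨τ, hτδ, hτ0, hτf⟩ := exists_flat_perturbation hdc hab hab1
    (fun p => hdne p a ⟨a, ⟨le_rfl, hab.le⟩, rfl⟩ ha)
        (fun p => hdne p b ⟨b, ⟨hab.le, le_rfl⟩, rfl⟩ hb) hδ
  set γ' := perturb R α r s τ γ with hγ'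
  obtain ⟨hγ'W, hγ'D⟩ := hpert τ hτδ
  refine ⟨γ', hγ'W, hbox.coherent_perturb hR hτ0, hγ'D, ?_⟩
  have hcase : ∀ u ∈ J, ∀ k l : ℤ, r ≤ k → k ≤ s → -(L₀ + L : ℤ) ≤ l → l ≤ L₀ + L →
      (l < r ∨ s < l) →
      FlatAt (coincidence R α γ' k l) u := by
    rintro _ ⟨t, ht, rfl⟩ k l h1 h2 h3 h4 h5
    refine FlatAt.of_real (FlatAtReal.congr ?_
        (hτf t ht ⟨(k, l), (hDmem _).2 ⟨⟨h1, h2⟩, ⟨h3, h4⟩, h5⟩⟩))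
    filter_upwards [Ioo_mem_nhds ht.1 ht.2] with x hx
    have hxJ : (x : Circ) ∈ J := ⟨x, hx, rfl⟩
    -- The arc does not return to itself within time `2 * L₀ + L`, so the outer time `l` is not
    -- affected by the perturbation.
    have hl : coord R α γ' l (x : Circ) = coord R α γ l (x : Circ) := by
      refine coord_congr (hR.perturb_apply_of_notMem hτ0 fun u hu m h6 h7 he => ?_)
      refine hdisj u hu x hxJ (l - m) (by omega) (by rw [abs_le]; omega) ?_
      exact eq_add_sub_zsmul he.symm
    change τ (x : Circ) = coord R α γ l (x : Circ) - coord R α γ k (x : Circ) ↔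
      coord R α γ' k (x : Circ) = coord R α γ' l (x : Circ)
    rw [hl, hbox.coord_perturb hR hτ0 hxJ h1 h2, eq_sub_iff_add_eq, add_comm]
  have hbd : ∀ (θ : Circ) (n : ℤ) (c : ℤ), |n| ≤ L → Separated α V θ 0 n →
      -(N : ℤ) ≤ c → c ≤ N → θ = c • α → -(N : ℤ) ≤ n + c → n + c ≤ N →
      FlatAt (coincidence R α γ' 0 n) θ := by
    rintro θ n c hn hsep h1 h2 rfl h3 h4
    exact FlatAt.of_notMem (hγ'D.notMem_coincidence hR (mem_Icc.2 (by omega))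
        (mem_Icc.2 (by omega)) hsep)
  intro θ n hn hsep hor
  have hn' := abs_le.1 hn
  -- Either `θ` or `θ + nα` is in the tower over the closed arc, or the graph is unchanged near both
  -- points. The closed arc makes the last case an open condition; its endpoints are settled by
  -- distinctness.
  by_cases c1 : ∃ u ∈ J', ∃ m, r ≤ m ∧ m ≤ s ∧ θ = u + m • α
  · obtain ⟨u, hu, m, h1, h2, rfl⟩ := c1
    by_cases huJ : u ∈ J
    · rw [separated_add, zero_add] at hsep
      rw [hR.flatAt_coincidence_add, zero_add]
      refine hcase u huJ m _ h1 h2 (by omega) (by omega) ?_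
      by_contra hc
      exact hbox.not_separated huJ h1 h2 (by omega) (by omega) hsep
    · obtain ⟨c, hc, rfl⟩ := hend u hu huJ
      rw [abs_le] at hc
      exact hbd _ n (c + m) hn hsep (by omega) (by omega) (by rw [add_zsmul]) (by omega) (by omega)
  by_cases c2 : ∃ u ∈ J', ∃ m, r ≤ m ∧ m ≤ s ∧ θ + n • α = u + m • α
  · obtain ⟨u, hu, m, h1, h2, he⟩ := c2
    obtain rfl := eq_add_sub_zsmul he
    by_cases huJ : u ∈ J
    · rw [separated_add, zero_add, add_sub_cancel] at hsep
      rw [hR.flatAt_coincidence_add, zero_add, add_sub_cancel, coincidence_comm]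
      refine hcase u huJ m _ h1 h2 (by omega) (by omega) ?_
      by_contra hc
      exact hbox.not_separated huJ h1 h2 (by omega) (by omega) hsep.symm
    · obtain ⟨c, hc, rfl⟩ := hend u hu huJ
      rw [abs_le] at hc
      exact hbd _ n (c + (m - n)) hn hsep (by omega) (by omega) (by rw [add_zsmul]) (by omega)
          (by omega)
  push Not at c1 c2
  have hopen : ∀ (m : ℤ), IsOpen {x : Circ | ∀ u ∈ J', x ≠ u + m • α} := by
    intro m
    have hc : Continuous fun x : Circ => x - m • α := by fun_prop
    convert hJ'c.isOpen_compl.preimage hc using 1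
    ext x
    constructor
    · intro h hx
      exact h _ hx (by rw [sub_add_cancel])
    · rintro h u hu rfl
      exact h (by simpa using hu)
  have hnear : ∀ x : Circ, (∀ u ∈ J', ∀ m, r ≤ m → m ≤ s → x ≠ u + m • α) → ∀ᶠ y in 𝓝 x,
      γ' y = γ y := by
    intro x hx
    have : ∀ᶠ y in 𝓝 x, ∀ m ∈ Finset.Icc r s, ∀ u ∈ J', y ≠ u + m • α := by
      refine (Filter.eventually_all_finset _).2 fun m hm => (hopen m).mem_nhds fun u hu => ?_
      rw [Finset.mem_Icc] at hm
      exact hx u hu m hm.1 hm.2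
    filter_upwards [this] with y hy
    exact hR.perturb_apply_of_notMem hτ0 fun u hu m h1 h2 => hy m (Finset.mem_Icc.2 ⟨h1, h2⟩) u
        (hJJ' hu)
  have hθJ : θ ∉ J := fun h => c1 θ (hJJ' h) 0 hbox.nonpos hbox.nonneg (by simp)
  refine FlatAt.congr ?_ (hor.resolve_left hθJ)
  have hc : Continuous fun x : Circ => x + n • α := continuous_id.add continuous_const
  filter_upwards [hnear θ c1, hc.continuousAt.eventually (hnear _ c2)] with y h1 h2
  change coord R α γ 0 y = coord R α γ n y ↔ coord R α γ' 0 y = coord R α γ' n y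
  rw [coord_congr (γ' := γ') (γ := γ) (k := 0) (by simpa using h1),
      coord_congr (γ' := γ') (γ := γ) (k := n) h2]

/-- Separated coincidences can be made flat, for bounded time differences. -/
theorem exists_flat_of_distinctOn (hR : IsSkew R α) (hα : DenseRange fun k : ℤ => k • α)
    (hV : IsClosed V) (hV0 : V ∈ 𝓝 (0 : Circ))
    (hfr : ∃ K : ℕ, ∀ x ∈ frontier V, ∃ k : ℤ, |k| ≤ K ∧ x = k • α) (L : ℕ) :
    ∃ N₀ : ℕ, ∀ N ≥ N₀, ∀ γ : C(Circ, Circ), DistinctOn R α V γ (Icc (-N : ℤ) N) → ∀ W ∈ 𝓝 γ,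
      ∃ γ' ∈ W, Coherent R α V γ γ' ∧ DistinctOn R α V γ' (Icc (-N : ℤ) N) ∧
        ∀ (θ : Circ) (n : ℤ), |n| ≤ L → Separated α V θ 0 n →
          FlatAt (coincidence R α γ' 0 n) θ := by
  classical
  obtain ⟨L₀, hvis⟩ := exists_visit_bound hα hV0
  obtain ⟨K, hK⟩ := hfr
  obtain ⟨c, hc, hc1, hcn⟩ := exists_le_norm_zsmul hα (2 * L₀ + L)
  -- An arc of length at least `c` would contain an orbit point within `c / 4` of its midpoint.
  obtain ⟨P, hP⟩ := exists_visit_bound hα (Metric.ball_mem_nhds (0 : Circ) (half_pos (half_pos hc)))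
  -- `P` makes the arcs shorter than `c`; `K + L₀` makes `G` contain the frontier of `V` translated
  -- by times up to `L₀`, so that visits are constant on each arc.
  set M : ℕ := max P (K + L₀) with hM
  set G : Set Circ := (fun k : ℤ => k • α) '' Icc (-M : ℤ) M with hG
  obtain ⟨A, hA, hAcov⟩ := exists_arcs (G := G) ((finite_Icc _ _).image _)
    ⟨0, mem_Icc.2 (by omega), by simp⟩
  have hGmem : ∀ x ∈ G, ∃ k : ℤ, |k| ≤ M ∧ x = k • α := by
    rintro _ ⟨k, hk, rfl⟩
    exact ⟨k, abs_le.2 hk, rfl⟩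
  have hlen : ∀ p ∈ A, p.2 - p.1 < c := by
    intro p hp
    by_contra! hcp
    obtain ⟨hlt, -, -, hno⟩ := hA p hp
    obtain ⟨⟨n, hnP, hn⟩, -⟩ := hP (-(((p.1 + p.2) / 2 : ℝ) : Circ))
    rw [mem_ball_zero_iff] at hn
    obtain ⟨e, he, hea⟩ := exists_lift_abs_eq_norm (-(((p.1 + p.2) / 2 : ℝ) : Circ) + (n : ℤ) • α)
    rw [← hea, abs_lt] at hn
    refine hno ((p.1 + p.2) / 2 + e) ⟨by linarith, by linarith⟩ ⟨n, mem_Icc.2 ?_, ?_⟩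
    · have := le_max_left P (K + L₀)
      omega
    · rw [AddCircle.coe_add, he]
      simp
  refine ⟨M + L₀ + L, fun N hN γ hγ W hW => ?_⟩
  obtain ⟨W', hW'W, hW'o, hγW'⟩ := mem_nhds_iff.1 hW
  suffices key : ∀ A' : Finset (ℝ × ℝ), A' ⊆ A → ∃ γ' ∈ W', Coherent R α V γ γ' ∧
      DistinctOn R α V γ' (Icc (-N : ℤ) N) ∧ ∀ (θ : Circ) (n : ℤ), |n| ≤ L → Separated α V θ 0 n →
        (∃ p ∈ A', θ ∈ ((↑) : ℝ → Circ) '' Ioo p.1 p.2) → FlatAt (coincidence R α γ' 0 n) θ by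
    obtain ⟨γ', h1, h2, h3, h4⟩ := key A subset_rfl
    refine ⟨γ', hW'W h1, h2, h3, fun θ n hn hs => ?_⟩
    by_cases hθ : θ ∈ G
    · obtain ⟨k, hk, rfl⟩ := hGmem θ hθ
      rw [abs_le] at hk hn
      exact FlatAt.of_notMem (h3.notMem_coincidence hR (mem_Icc.2 (by omega))
          (mem_Icc.2 (by omega)) hs)
    · exact h4 θ n hn hs (hAcov θ hθ)
  intro A'
  induction A' using Finset.induction_on with
  | empty => exact fun _ => ⟨γ, hγW', Coherent.refl γ, hγ, by simp⟩
  | insert p A' _ ih =>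
    intro hsub
    have hpA := hsub (Finset.mem_insert_self p A')
    obtain ⟨γ₁, hγ₁W, hc₁, hd₁, hf₁⟩ := ih ((Finset.subset_insert p A').trans hsub)
    obtain ⟨hlt, h1G, h2G, hno⟩ := hA p hpA
    have hl := hlen p hpA
    obtain ⟨r, s, hr, hs, hbox⟩ := exists_isBox_of_isPreconnected (α := α) (V := V)
      (isPreconnected_Ioo.image ((↑) : ℝ → Circ) continuous_coe.continuousOn
          (s := Ioo p.1 p.2)) hvis (by
        rintro _ ⟨t, ht, rfl⟩ m h1 h2 hm
        obtain ⟨k, hk, he⟩ := hK _ hm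
        refine hno t ht ⟨k - m, mem_Icc.2 ?_, ?_⟩
        · have := le_max_right P (K + L₀)
          rw [abs_le] at hk
          omega
        · change (k - m) • α = _
          rw [sub_zsmul, ← he, ← sub_eq_add_neg, add_sub_cancel_right])
    obtain ⟨γ₂, hγ₂W, hc₂, hd₂, hf₂⟩ := exists_flat_over_arc (L := L) (M := M) hR hV hlt
        (by linarith)
      (hGmem _ h1G) (hGmem _ h2G) hbox hr hs (by
        rintro _ ⟨t, ht, rfl⟩ _ ⟨t', ht', rfl⟩ n hn hnB he
        have h1 := hcn n hn (by exact_mod_cast hnB)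
        have h2 : n • α = ((t - t' : ℝ) : Circ) := by
          rw [AddCircle.coe_sub, he, add_sub_cancel_left]
        rw [h2] at h1
        have h3 : |t - t'| < c := by
          rw [abs_lt]
          constructor <;> linarith [ht.1, ht.2, ht'.1, ht'.2]
        linarith [norm_coe_le_abs (t - t')]) hN hd₁ (hW'o.mem_nhds hγ₁W)
    refine ⟨γ₂, hγ₂W, hc₁.trans hc₂, hd₂, fun θ n hn hs hex => hf₂ θ n hn hs ?_⟩
    obtain ⟨p', hp', hθ⟩ := hex
    rcases Finset.mem_insert.1 hp' with rfl | hp'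
    · exact Or.inl hθ
    · exact Or.inr (hf₁ θ n hn hs ⟨p', hp', hθ⟩)

end

section

variable {R : Torus ≃ₜ Torus} {α : Circ} {V : Set Circ} {γ : C(Circ, Circ)}

/-! ### Stages of the construction -/

/-- Closed neighbourhoods of `0` whose frontier lies in a finite part of the orbit of `0`. -/
structure IsCut (α : Circ) (V : Set Circ) : Prop where
  isClosed : IsClosed V
  mem_nhds : V ∈ 𝓝 (0 : Circ)
  frontier : ∃ K : ℕ, ∀ x ∈ frontier V, ∃ k : ℤ, |k| ≤ K ∧ x = k • α

/-- A graph whose coincidences along orbit segments not cut by `V` are flat. -/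
structure IsStage (R : Torus ≃ₜ Torus) (α : Circ) (V : Set Circ) (γ : C(Circ, Circ)) : Prop where
  cut : IsCut α V
  flat : ∀ θ i j, ¬ Separated α V θ i j → FlatAt (coincidence R α γ i j) θ
  distinct : ∃ M : ℕ, DistinctOn R α V γ (Icc (-M : ℤ) M) ∧
    ∀ k ∉ Icc (-M : ℤ) M, ∃ r s : ℤ, ∃ J ∈ 𝓝 (k • α), IsBox α V J r s

theorem IsCut.exists_isBox_nhds_zsmul (hα : DenseRange fun k : ℤ => k • α) (hV : IsCut α V) :
    ∃ M : ℕ, ∀ k ∉ Icc (-M : ℤ) M, ∃ r s : ℤ, ∃ J ∈ 𝓝 (k • α), IsBox α V J r s := by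
  obtain ⟨L, hL⟩ := exists_visit_bound hα hV.mem_nhds
  obtain ⟨K, hK⟩ := hV.frontier
  refine ⟨K + L, fun k hk => exists_isBox_nhds (hL _).1 (hL _).2 fun m h1 h2 hm => hk ?_⟩
  obtain ⟨c, hc, he⟩ := hK _ hm
  rw [← add_zsmul] at he
  have := zsmul_injective_of_denseRange hα he
  rw [abs_le] at hc
  exact mem_Icc.2 (by omega)

/-- A closed ball of radius `‖q • α‖` has frontier contained in `{q • α, -q • α}`. -/
theorem exists_isCut_subset (hα : DenseRange fun k : ℤ => k • α) {U : Set Circ}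
    (hU : U ∈ 𝓝 (0 : Circ)) : ∃ V ⊆ U, IsCut α V := by
  obtain ⟨ε, hε, hball⟩ := Metric.mem_nhds_iff.1 hU
  have hne : (Metric.ball (0 : Circ) ε ∩ {0}ᶜ).Nonempty := by
    refine ⟨((min ε 1 / 2 : ℝ) : Circ), ?_, coe_ne_zero_of_abs_lt_one (by positivity) ?_⟩
    · rw [mem_ball_zero_iff]
      refine (norm_coe_le_abs _).trans_lt ?_
      rw [abs_of_pos (by positivity)]
      linarith [min_le_left ε 1]
    · rw [abs_of_pos (by positivity)]
      linarith [min_le_right ε 1]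
  obtain ⟨q, hq, hq0⟩ := hα.exists_mem_open (Metric.isOpen_ball.inter isOpen_compl_singleton) hne
  rw [mem_ball_zero_iff] at hq
  refine ⟨Metric.closedBall 0 ‖q • α‖, (Metric.closedBall_subset_ball hq).trans hball,
    Metric.isClosed_closedBall, Metric.closedBall_mem_nhds _ (norm_pos_iff.2 hq0), q.natAbs,
        fun x hx => ?_⟩
  have hx' := Metric.frontier_closedBall_subset_sphere hx
  rw [mem_sphere_zero_iff_norm] at hx'
  obtain ⟨t, ht, hta⟩ := exists_lift_abs_eq_norm x
  obtain ⟨t', ht', hta'⟩ := exists_lift_abs_eq_norm (q • α)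
  rw [← hta, ← hta', abs_eq_abs] at hx'
  rcases hx' with h | h
  · exact ⟨q, by simp, by rw [← ht, h, ht']⟩
  · exact ⟨-q, by simp, by rw [← ht, h, AddCircle.coe_neg, ht', neg_zsmul]⟩

theorem exists_bound_of_not_separated (hα : DenseRange fun k : ℤ => k • α)
    (hV : V ∈ 𝓝 (0 : Circ)) :
    ∃ L : ℕ, ∀ θ i j, ¬ Separated α V θ i j → |j - i| ≤ L := by
  obtain ⟨L, hL⟩ := exists_visit_bound hα hV
  have key : ∀ θ i j, ¬ Separated α V θ i j → j - i ≤ L := by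
    intro θ i j h
    by_contra! hlt
    obtain ⟨n, hn, hnV⟩ := (hL (θ + i • α)).1
    rw [add_assoc, ← add_zsmul] at hnV
    exact h ⟨i + n, by omega, hnV⟩
  refine ⟨L, fun θ i j h => abs_le.2 ⟨?_, key θ i j h⟩⟩
  have := key θ j i fun h' => h h'.symm
  omega

theorem IsStage.eventually_of_coherent (h : IsStage R α V γ) :
    ∀ᶠ γ' in 𝓝 γ, Coherent R α V γ γ' → IsStage R α V γ' := by
  obtain ⟨M, hd, hb⟩ := h.distinct
  filter_upwards [hd.eventually (finite_Icc _ _)] with γ' hγ' hc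
  exact ⟨h.cut, fun θ i j hs => hc.flatAt h.cut.isClosed hs (h.flat θ i j hs), M, hγ', hb⟩

/-- A pair of times not separated by `V'` is either not separated by `V`, and coherence preserves
its flatness, or separated by `V` with bounded difference, and `exists_flat_of_distinctOn` applies.
That step first needs distinct values on a long stretch of the orbit of `0`. -/
theorem IsStage.exists_next (hR : IsSkew R α) (hα : DenseRange fun k : ℤ => k • α)
    (h : IsStage R α V γ) {W : Set C(Circ, Circ)} (hW : W ∈ 𝓝 γ) {U : Set Circ}
    (hU : U ∈ 𝓝 (0 : Circ)) (N₁ : ℕ) :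
    ∃ γ' ∈ W, ∃ V' ⊆ V ∩ U, IsStage R α V' γ' ∧ Coherent R α V γ γ' ∧
      DistinctOn R α V γ' (Icc (-N₁ : ℤ) N₁) := by
  obtain ⟨V', hV'U, hV'⟩ := exists_isCut_subset hα (inter_mem h.cut.mem_nhds hU)
  obtain ⟨L, hL⟩ := exists_bound_of_not_separated hα hV'.mem_nhds
  obtain ⟨M', hM'⟩ := hV'.exists_isBox_nhds_zsmul hα
  obtain ⟨N₀, hflat⟩ := exists_flat_of_distinctOn hR hα h.cut.isClosed h.cut.mem_nhds h.cut.frontier L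
  set N := max N₀ (max N₁ M') with hN
  obtain ⟨W', hW'W, hW'o, hγW'⟩ := mem_nhds_iff.1 hW
  obtain ⟨M, hd, hb⟩ := h.distinct
  obtain ⟨γ₁, hγ₁W, hc₁, hd₁⟩ := hd.exists_union hR hα (finite_Icc _ _) hb (Finset.Icc (-N : ℤ) N)
    (hW'o.mem_nhds hγW')
  have hd₁' : DistinctOn R α V γ₁ (Icc (-N : ℤ) N) := fun k hk l hl =>
    hd₁ k (Or.inr (by simpa using hk)) l (Or.inr (by simpa using hl))
  obtain ⟨γ₂, hγ₂W, hc₂, hd₂, hf₂⟩ := hflat N (le_max_left _ _) γ₁ hd₁' _ (hW'o.mem_nhds hγ₁W)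
  have hN₁ : N₁ ≤ N := (le_max_left _ _).trans (le_max_right _ _)
  have hNM' : M' ≤ N := (le_max_right _ _).trans (le_max_right _ _)
  have hV'V : V' ⊆ V := hV'U.trans inter_subset_left
  have hc := hc₁.trans hc₂
  refine ⟨γ₂, hW'W hγ₂W, V', hV'U, ⟨hV', fun θ i j hs => ?_, M', ?_, hM'⟩, hc, ?_⟩
  · by_cases hsV : Separated α V θ i j
    · have h1 := (separated_add (α := α) (V := V) (θ := θ) (i := 0) (j := j - i) (k := i)).2
        (by simpa using hsV)
      have h2 := hf₂ (θ + i • α) (j - i) (hL θ i j hs) h1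
      rw [hR.flatAt_coincidence_add] at h2
      simpa using h2
    · exact hc.flatAt h.cut.isClosed hsV (h.flat θ i j hsV)
  · intro k hk l hl hs
    rw [mem_Icc] at hk hl
    exact hd₂ k (mem_Icc.2 (by omega)) l (mem_Icc.2 (by omega)) (hs.mono hV'V)
  · intro k hk l hl hs
    rw [mem_Icc] at hk hl
    exact hd₂ k (mem_Icc.2 (by omega)) l (mem_Icc.2 (by omega)) hs

/-- Here distinct times are always separated, so any graph can serve as the initial one. -/
theorem isStage_univ (R : Torus ≃ₜ Torus) (α : Circ) (γ : C(Circ, Circ)) : IsStage R α univ γ where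
  cut := ⟨isClosed_univ, univ_mem, 0, by simp⟩
  flat := by
    intro θ i j hs
    have hij : i = j := by
      by_contra hne
      exact hs ⟨min i j, by omega, mem_univ _⟩
    subst hij
    exact fun _ => Or.inl (Eventually.of_forall fun _ => rfl)
  distinct := by
    refine ⟨0, ?_, fun k _ => ⟨0, 0, univ, univ_mem, ?_⟩⟩
    · rintro k hk l hl ⟨m, hm, -⟩
      simp only [Nat.cast_zero, neg_zero, Icc_self, mem_singleton_iff] at hk hl
      omega
    · exact ⟨le_rfl, le_rfl, fun _ _ => mem_univ _, fun _ _ => mem_univ _, fun _ _ m h1 h2 =>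
          by omega⟩

/-! ### The limit graph -/

/-- A Baire-type construction with nested closed balls whose centres are stages. The sets `X k` are
extra open conditions that arbitrarily small coherent perturbations can achieve. -/
theorem exists_limit_graph (hR : IsSkew R α) (hα : DenseRange fun k : ℤ => k • α)
    {X : ℕ → Set C(Circ, Circ)} (hXo : ∀ k, IsOpen (X k))
    (hX : ∀ k V (γ : C(Circ, Circ)), IsCut α V → ∀ W ∈ 𝓝 γ, ∃ γ' ∈ W, γ' ∈ X k ∧
        Coherent R α V γ γ') :
    ∃ γ : C(Circ, Circ), (∀ n θ, FlatAt (coincidence R α γ 0 n) θ) ∧ ∀ k, γ ∈ X k := by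
  let State := {p : C(Circ, Circ) × Set Circ × ℝ // IsStage R α p.2.1 p.1 ∧ 0 < p.2.2}
  -- The thickening clause prevents new coincidences from appearing far from the existing ones.
  -- Imposed on a whole closed ball, all clauses pass to the limit.
  let Good : ℕ → Set Circ → C(Circ, Circ) → C(Circ, Circ) → Prop := fun k V γ' γ'' =>
    γ'' ∈ X k ∧ DistinctOn R α V γ'' (Icc (-k : ℤ) k) ∧
      ∀ n ∈ Icc (-k : ℤ) k, ∀ θ ∈ (Metric.thickening (1 / (k + 1 : ℝ)) (coincidence R α γ' 0 n))ᶜ,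
        θ ∉ coincidence R α γ'' 0 n
  let Rel : ℕ → State → State → Prop := fun k p p' =>
    Metric.closedBall p'.1.1 p'.1.2.2 ⊆ Metric.closedBall p.1.1 p.1.2.2 ∧
      p'.1.2.2 ≤ 1 / (k + 1 : ℝ) ∧ p'.1.2.1 ⊆ p.1.2.1 ∧
      p'.1.2.1 ⊆ Metric.ball 0 (1 / (k + 1 : ℝ)) ∧ Coherent R α p.1.2.1 p.1.1 p'.1.1 ∧
      ∀ γ'' ∈ Metric.closedBall p'.1.1 p'.1.2.2, Good k p.1.2.1 p'.1.1 γ''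
  have hstep : ∀ k p, ∃ p', Rel k p p' := by
    rintro k ⟨⟨γ, V, ρ⟩, hst, hρ⟩
    dsimp only at hst hρ
    have hk : (0 : ℝ) < 1 / (k + 1 : ℝ) := by positivity
    obtain ⟨γ₁, hγ₁, hγ₁X, hc₁⟩ := hX k V γ hst.cut _
      (inter_mem hst.eventually_of_coherent (Metric.ball_mem_nhds γ hρ))
    have hst₁ : IsStage R α V γ₁ := hγ₁.1 hc₁
    obtain ⟨γ', hγ', V', hV', hst', hc', hd'⟩ := hst₁.exists_next hR hα
      (inter_mem (Metric.isOpen_ball.mem_nhds hγ₁.2) ((hXo k).mem_nhds hγ₁X))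
      (Metric.ball_mem_nhds (0 : Circ) hk) k
    have hgood : ∀ᶠ γ'' in 𝓝 γ', Good k V γ' γ'' ∧ γ'' ∈ Metric.ball γ ρ := by
      refine Filter.Eventually.and (Filter.Eventually.and ((hXo k).mem_nhds hγ'.2)
        ((hd'.eventually (finite_Icc _ _)).and
            ((finite_Icc (-k : ℤ) k).eventually_all.2 fun n _ => ?_)))
        (Metric.isOpen_ball.mem_nhds hγ'.1)
      refine (isOpen_setOf_disjoint_coincidence (R := R) (α := α)
        Metric.isOpen_thickening.isClosed_compl.isCompact 0 n).mem_nhds fun θ hθ hθ' => hθ ?_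
      exact Metric.self_subset_thickening hk _ hθ'
    obtain ⟨ρ', hρ', hball⟩ := Metric.nhds_basis_closedBall.eventually_iff.1 hgood
    refine ⟨⟨(γ', V', min ρ' (1 / (k + 1 : ℝ))), hst', lt_min hρ' hk⟩, ?_, min_le_right _ _,
      hV'.trans inter_subset_left, hV'.trans inter_subset_right, hc₁.trans hc', ?_⟩
    · exact fun x hx => Metric.ball_subset_closedBall
        (hball (Metric.closedBall_subset_closedBall (min_le_left _ _) hx)).2
    · exact fun x hx => (hball (Metric.closedBall_subset_closedBall (min_le_left _ _) hx)).1
  choose f hf using hstep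
  let s : ℕ → State := fun k => Nat.rec
    ⟨(ContinuousMap.const Circ 0, univ, 1), isStage_univ R α _, one_pos⟩ (fun k p => f k p) k
  have hs : ∀ k, Rel k (s k) (s (k + 1)) := fun k => hf k (s k)
  have hanti : Antitone fun k => Metric.closedBall (s k).1.1 (s k).1.2.2 :=
    antitone_nat_of_succ_le fun k => (hs k).1
  have hVanti : Antitone fun k => (s k).1.2.1 := antitone_nat_of_succ_le fun k => (hs k).2.2.1
  have hmem : ∀ k l, k ≤ l → (s l).1.1 ∈ Metric.closedBall (s k).1.1 (s k).1.2.2 := fun k l hkl =>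
    hanti hkl (Metric.mem_closedBall_self (s l).2.2.le)
  have hcauchy : CauchySeq fun k => (s (k + 1)).1.1 := by
    refine cauchySeq_of_le_tendsto_0 (fun k : ℕ => 1 / (k + 1 : ℝ) + 1 / (k + 1 : ℝ)) ?_ ?_
    · intro n m N hn hm
      have h1 := Metric.mem_closedBall.1 (hmem (N + 1) (n + 1) (by omega))
      have h2 := Metric.mem_closedBall.1 (hmem (N + 1) (m + 1) (by omega))
      exact (dist_triangle_right _ _ _).trans
          (add_le_add (h1.trans (hs N).2.1) (h2.trans (hs N).2.1))
    · simpa using (tendsto_one_div_add_atTop_nhds_zero_nat (𝕜 := ℝ)).add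
        tendsto_one_div_add_atTop_nhds_zero_nat
  obtain ⟨γ, hγ⟩ := cauchySeq_tendsto_of_complete hcauchy
  have hγmem : ∀ k, γ ∈ Metric.closedBall (s k).1.1 (s k).1.2.2 := fun k =>
    Metric.isClosed_closedBall.mem_of_tendsto hγ
      ((eventually_ge_atTop k).mono fun l hl => hmem k (l + 1) (by omega))
  have hgood : ∀ k, Good k (s k).1.2.1 (s (k + 1)).1.1 γ := fun k => (hs k).2.2.2.2.2 γ
      (hγmem (k + 1))
  refine ⟨γ, fun n θ => ?_, fun k => (hgood k).1⟩
  -- Near an uncut segment all later stages have the same coincidences. The limit keeps them by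
  -- closedness and gains none by the thickening clause.
  by_cases hcase : ∃ k, ¬ Separated α (s k).1.2.1 θ 0 n
  · obtain ⟨k₀, hk₀⟩ := hcase
    have hcut := (s k₀).2.1.cut
    have hsame : ∀ k, k₀ ≤ k → ∀ x, ¬ Separated α (s k₀).1.2.1 x 0 n →
        (x ∈ coincidence R α (s k).1.1 0 n ↔ x ∈ coincidence R α (s k₀).1.1 0 n) := by
      intro k hk x hx
      induction k, hk using Nat.le_induction with
      | base => rfl
      | succ k hk ih =>
        exact ((hs k).2.2.2.2.1 x 0 n fun h => hx (h.mono (hVanti hk))).trans ih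
    refine ((s k₀).2.1.flat θ 0 n hk₀).congr ?_
    filter_upwards [eventually_not_separated hcut.isClosed hk₀] with x hx
    constructor
    · intro hxc
      have hcl : IsClosed {γ' : C(Circ, Circ) | x ∈ coincidence R α γ' 0 n} :=
        isClosed_eq (continuous_coord_apply R α 0 x) (continuous_coord_apply R α n x)
      exact hcl.mem_of_tendsto hγ ((eventually_ge_atTop k₀).mono fun k hk =>
        (hsame (k + 1) (by omega) x hx).2 hxc)
    · intro hxγ
      by_contra hxc
      obtain ⟨ε, hε, hball⟩ := Metric.eventually_nhds_iff_ball.1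
        ((eventually_not_separated hcut.isClosed hx).and
          ((isClosed_coincidence (R := R) (α := α) (s k₀).1.1 0 n).isOpen_compl.mem_nhds hxc))
      obtain ⟨k₁, hk₁⟩ := exists_nat_one_div_lt hε
      set k := max k₀ (max k₁ n.natAbs) with hk
      have hkk₁ : k₁ ≤ k := (le_max_left _ _).trans (le_max_right _ _)
      have hkn : n.natAbs ≤ k := (le_max_right _ _).trans (le_max_right _ _)
      have hkε : 1 / (k + 1 : ℝ) < ε := (Nat.one_div_le_one_div hkk₁).trans_lt hk₁
      refine (hgood k).2.2 n (mem_Icc.2 (by omega)) x (fun hth => ?_) hxγ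
      obtain ⟨y, hy, hxy⟩ := Metric.mem_thickening_iff.1 hth
      have hyb : y ∈ Metric.ball x ε := by
        rw [Metric.mem_ball, dist_comm]
        exact hxy.trans hkε
      exact (hball y hyb).2 ((hsame (k + 1) (by omega) y (hball y hyb).1).1 hy)
  · push Not at hcase
    -- The sets `V` shrink to `0`, so a finite orbit segment cut by all of them contains `0`.
    obtain ⟨m, hm, hm0⟩ : ∃ m ∈ Finset.Ico (min 0 n) (max 0 n), θ + m • α = 0 := by
      by_contra! hne
      have hpos : ∀ᶠ ε : ℝ in 𝓝[>] 0, ∀ m ∈ Finset.Ico (min 0 n) (max 0 n), ε < ‖θ + m • α‖ :=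
        (Filter.eventually_all_finset _).2 fun m hm =>
          nhdsWithin_le_nhds (Iio_mem_nhds (norm_pos_iff.2 (hne m hm)))
      obtain ⟨ε, hε, hε0⟩ := (hpos.and self_mem_nhdsWithin).exists
      obtain ⟨k, hk⟩ := exists_nat_one_div_lt hε0
      obtain ⟨m, hm, hmV⟩ := hcase (k + 1)
      have h1 := mem_ball_zero_iff.1 ((hs k).2.2.2.1 hmV)
      have h2 := hε m (Finset.mem_Ico.2 (by omega))
      linarith
    rw [Finset.mem_Ico] at hm
    have hθ : θ = (-m) • α := by rw [neg_zsmul]; exact eq_neg_of_add_eq_zero_left hm0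
    have hd := (hgood (m.natAbs + n.natAbs)).2.1
    subst hθ
    exact FlatAt.of_notMem (hd.notMem_coincidence hR (mem_Icc.2 (by omega)) (mem_Icc.2 (by omega))
      (hcase _))

end

section

variable {R : Torus ≃ₜ Torus} {α : Circ} {V : Set Circ} {γ : C(Circ, Circ)}

/-! ### Crossings -/

/-- A quantitative form of crossing, between the graph over `U₁` and an image of the graph
over `U₂`. -/
def Crosses (R : Torus ≃ₜ Torus) (α : Circ) (γ : C(Circ, Circ)) (U₁ U₂ : Set Circ) : Prop :=
  ∃ (n : ℕ) (a b : ℝ) (c : Circ), a ≤ b ∧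
    (∀ t ∈ Icc a b, (t : Circ) ∈ U₁ ∧ (t : Circ) - (n : ℤ) • α ∈ U₂) ∧
    (∀ x ∈ ((↑) : ℝ → Circ) '' Icc a b, γ x ∈ Metric.ball c (1 / 8)) ∧
    (∀ x ∈ ((↑) : ℝ → Circ) '' Icc a b, coord R α γ (-n) x ∈ Metric.ball c (1 / 8)) ∧
    signedNorm (γ a - c) < signedNorm (coord R α γ (-n) a - c) ∧
    signedNorm (coord R α γ (-n) b - c) < signedNorm (γ b - c)

/-- The same `n`, `a`, `b`, `c` work nearby: the conditions on the graph are strict inequalities and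
inclusions of compact images in open balls. -/
theorem isOpen_setOf_crosses (U₁ U₂ : Set Circ) :
    IsOpen {γ : C(Circ, Circ) | Crosses R α γ U₁ U₂} := by
  rw [isOpen_iff_mem_nhds]
  rintro γ ⟨n, a, b, c, hab, hU, h1, h2, h3, h4⟩
  have hK : IsCompact (((↑) : ℝ → Circ) '' Icc a b) := isCompact_Icc.image continuous_coe
  have o1 := ContinuousMap.isOpen_setOfPred_mapsTo (X := Circ) hK
      (Metric.isOpen_ball (x := c) (ε := 1 / 8))
  have o2 := o1.preimage (continuous_coordMap R α (-n))
  have o3 : IsOpen {γ : C(Circ, Circ) |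
      signedNorm (γ a - c) < signedNorm (coord R α γ (-n) a - c)} :=
    isOpen_lt (continuous_signedNorm.comp (by fun_prop))
      (continuous_signedNorm.comp ((continuous_coord_apply R α _ _).sub continuous_const))
  have o4 : IsOpen {γ : C(Circ, Circ) |
      signedNorm (coord R α γ (-n) b - c) < signedNorm (γ b - c)} :=
    isOpen_lt (continuous_signedNorm.comp ((continuous_coord_apply R α _ _).sub continuous_const))
      (continuous_signedNorm.comp (by fun_prop))
  filter_upwards [o1.mem_nhds h1, o2.mem_nhds (x := γ) h2, o3.mem_nhds h3, o4.mem_nhds h4]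
    with γ' k1 k2 k3 k4
  exact ⟨n, a, b, c, hab, hU, k1, k2, k3, k4⟩

theorem iterate_eq_zpow (R : Torus ≃ₜ Torus) (n : ℕ) (z : Torus) :
    R^[n] z = (R ^ (n : ℤ)) z := by
  induction n generalizing z with
  | zero => simp
  | succ n ih =>
    rw [Function.iterate_succ_apply, ih, Nat.cast_succ, zpow_add_one, Homeomorph.mul_apply]

theorem IsTransitive.exists_ge (h : IsTransitive R) {U V : Set Torus} (hU : IsOpen U)
    (hV : IsOpen V) (hU' : U.Nonempty) (hV' : V.Nonempty) (n₀ : ℕ) :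
    ∃ n ≥ n₀, ∃ z ∈ U, (R ^ (n : ℤ)) z ∈ V := by
  have ho : IsOpen ((R ^ (n₀ : ℤ)) '' U) := (R ^ (n₀ : ℤ)).isOpenMap _ hU
  obtain ⟨n, _, ⟨_, ⟨z, hz, rfl⟩, rfl⟩, hw⟩ := h _ V ho hV (hU'.image _) hV'
  refine ⟨n + n₀, by omega, z, hz, ?_⟩
  rw [iterate_eq_zpow, ← Homeomorph.mul_apply, ← zpow_add] at hw
  exact_mod_cast hw

theorem IsCut.exists_isBox_of_isOpen (hα : DenseRange fun k : ℤ => k • α) (hV : IsCut α V)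
    {U : Set Circ} (hU : IsOpen U) (hne : U.Nonempty) :
    ∃ r s : ℤ, ∃ J ⊆ U, IsOpen J ∧ J.Nonempty ∧ IsBox α V J r s := by
  obtain ⟨L, hL⟩ := exists_visit_bound hα hV.mem_nhds
  obtain ⟨K, hK⟩ := hV.frontier
  have hfin : ((fun k : ℤ => k • α) '' Icc (-(K + L) : ℤ) (K + L)).Finite :=
      (finite_Icc _ _).image _
  have : Nontrivial Circ := ⟨((1 / 2 : ℝ) : Circ), 0, coe_ne_zero_of_abs_lt_one (by norm_num)
    (by rw [abs_of_pos] <;> norm_num)⟩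
  obtain ⟨θ, hθ, hθU⟩ := (dense_univ.sdiff_finite hfin).exists_mem_open hU hne
  obtain ⟨r, s, J, hJ, hbox⟩ := exists_isBox_nhds (α := α) (V := V) (hL θ).1 (hL θ).2 (by
    intro m h1 h2 hm
    obtain ⟨c, hc, he⟩ := hK _ hm
    rw [abs_le] at hc
    refine hθ.2 ⟨c - m, mem_Icc.2 (by omega), ?_⟩
    change (c - m) • α = θ
    rw [sub_zsmul, ← he, ← sub_eq_add_neg, add_sub_cancel_right])
  exact ⟨r, s, interior J ∩ U, inter_subset_right, isOpen_interior.inter hU,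
    ⟨θ, mem_interior_iff_mem_nhds.2 hJ, hθU⟩, hbox.mono (inter_subset_left.trans interior_subset)⟩

/-- Bending the graph near a single point so that it crosses one of its images. -/
theorem IsBox.exists_crosses {J : Set Circ} {r s : ℤ} (hbox : IsBox α V J r s) (hR : IsSkew R α)
    (hα : DenseRange fun k : ℤ => k • α) {θ : Circ} (hJ : J ∈ 𝓝 θ) {n : ℕ} (hn : -r < n)
    {δ : ℝ} (hδ8 : δ ≤ 1 / 8) (hclose : ‖coord R α γ (-n) θ - γ θ‖ < δ)
    {U₁ U₂ : Set Circ} (hU₁ : U₁ ∈ 𝓝 θ) (hU₂ : U₂ ∈ 𝓝 (θ - (n : ℤ) • α)) :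
    ∃ τ : C(Circ, Circ), (∀ x, ‖τ x‖ < δ) ∧ (∀ x ∉ J, τ x = 0) ∧
      Crosses R α (perturb R α r s τ γ) U₁ U₂ := by
  have hδ : 0 < δ := (norm_nonneg _).trans_lt hclose
  obtain ⟨c, hc, -, hcn⟩ := exists_le_norm_zsmul hα (s.natAbs + r.natAbs + n)
  -- Adding `g` to `γ` produces the image curve plus `x - θ`, which passes from below that curve to
  -- above it at `θ`.
  set g : Circ → Circ := fun x => coord R α γ (-n) x - γ x + (x - θ) with hg
  have hgc : Continuous g := by fun_prop
  have hgθ : ‖g θ‖ < δ := by simpa [hg] using hclose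
  set N : Set Circ := J ∩ Metric.ball θ (c / 2) ∩ {x | ‖g x‖ < δ} with hN
  have hNθ : N ∈ 𝓝 θ := inter_mem (inter_mem hJ (Metric.ball_mem_nhds _ (half_pos hc)))
    ((isOpen_lt hgc.norm continuous_const).mem_nhds hgθ)
  obtain ⟨φ, hφ1, hφ, hφ0⟩ := exists_bump hNθ
  set τ : C(Circ, Circ) := ⟨fun x => ((φ x * signedNorm (g x) : ℝ) : Circ),
    continuous_coe.comp (φ.continuous.mul (continuous_signedNorm.comp hgc))⟩ with hτ
  have hboxN : IsBox α V N r s := hbox.mono (inter_subset_left.trans inter_subset_left)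
  have hτ0 : ∀ x ∉ N, τ x = 0 := fun x hx => by simp [hτ, hφ0 x hx]
  have hτδ : ∀ x, ‖τ x‖ < δ := by
    intro x
    by_cases hx : x ∈ N
    · refine (norm_coe_le_abs _).trans_lt (lt_of_le_of_lt ?_ hx.2)
      rw [abs_mul, abs_of_nonneg (hφ x).1]
      exact (mul_le_of_le_one_left (abs_nonneg _) (hφ x).2).trans (abs_signedNorm_le _)
    · rw [hτ0 x hx, norm_zero]
      exact hδ
  refine ⟨τ, hτδ, fun x hx => hτ0 x fun h => hx h.1.1, ?_⟩
  set γ' := perturb R α r s τ γ with hγ'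
  -- As `n > -r`, time `-n` is outside the block, and `N` is too short to meet its translates by `m
  -- + n`; the image curve over `N` does not move.
  have hcoord : ∀ x ∈ N, coord R α γ' (-n) x = coord R α γ (-n) x := by
    intro x hx
    refine coord_congr (hR.perturb_apply_of_notMem hτ0 fun u hu m h1 h2 he => ?_)
    have h3 := hcn (m + n) (by omega) (by rw [abs_le]; constructor <;> omega)
    have h4 : x - u = (m + n : ℤ) • α := by
      rw [eq_add_sub_zsmul he, sub_neg_eq_add, add_sub_cancel_left]
    rw [← h4, ← dist_eq_norm] at h3
    have h5 := hx.1.2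
    have h6 := hu.1.2
    rw [Metric.mem_ball] at h5 h6
    linarith [dist_triangle_right x u θ]
  have hval : ∀ x ∈ N, φ x = 1 → γ' x = coord R α γ (-n) x + (x - θ) := by
    intro x hx hx1
    have := hboxN.coord_perturb hR hτ0 hx hbox.nonpos hbox.nonneg (γ := γ)
    rw [coord_zero, coord_zero] at this
    rw [hγ', this]
    change γ x + ((φ x * signedNorm (g x) : ℝ) : Circ) = _
    rw [hx1, one_mul, coe_signedNorm (hx.2.le.trans (by linarith))]
    simp only [hg]
    abel
  obtain ⟨t₀, rfl, -⟩ := exists_lift_abs_eq_norm θ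
  set y := coord R α γ (-n) (t₀ : Circ) with hy
  have hnear : ∀ᶠ x in 𝓝 (t₀ : Circ), x ∈ N ∧ φ x = 1 ∧ x ∈ U₁ ∧ x - (n : ℤ) • α ∈ U₂ ∧
      dist (coord R α γ (-n) x) y < 1 / 16 := by
    have hc1 : Continuous fun x : Circ => x - (n : ℤ) • α := by fun_prop
    refine (Filter.eventually_mem_set.2 hNθ).and (hφ1.and ((Filter.eventually_mem_set.2 hU₁).and
      ((hc1.continuousAt.eventually (Filter.eventually_mem_set.2 hU₂)).and ?_)))
    exact (continuous_coord R α γ (-n)).continuousAt.eventually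
        (Metric.ball_mem_nhds y (by norm_num))
  obtain ⟨η₀, hη₀, hnear⟩ := Metric.eventually_nhds_iff.1
      (continuous_coe.continuousAt.eventually hnear)
  obtain ⟨η, hη, hηη₀, hη16⟩ : ∃ η > 0, η < η₀ ∧ η < 1 / 16 := by
    refine ⟨min η₀ (1 / 16) / 2, by positivity, ?_, ?_⟩
    · linarith [min_le_left η₀ (1 / 16), show 0 < min η₀ (1 / 16) by positivity]
    · linarith [min_le_right η₀ (1 / 16), show 0 < min η₀ (1 / 16) by positivity]
  have hI : ∀ t ∈ Icc (t₀ - η) (t₀ + η), ∃ h : ℝ, |h| < 1 / 16 ∧ |t - t₀| ≤ η ∧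
      (t : Circ) ∈ U₁ ∧ (t : Circ) - (n : ℤ) • α ∈ U₂ ∧
      coord R α γ' (-n) (t : Circ) - y = (h : Circ) ∧ γ' (t : Circ) - y =
          ((h + (t - t₀) : ℝ) : Circ) := by
    intro t ht
    have htη : |t - t₀| ≤ η := abs_le.2 ⟨by linarith [ht.1], by linarith [ht.2]⟩
    obtain ⟨k1, k2, k3, k4, k5⟩ := hnear (y := t) (by rw [Real.dist_eq]; exact htη.trans_lt hηη₀)
    rw [dist_eq_norm] at k5
    obtain ⟨h, hh, hha⟩ := exists_lift_abs_eq_norm (coord R α γ (-n) (t : Circ) - y)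
    refine ⟨h, by rw [hha]; exact k5, htη, k3, k4, by rw [hcoord _ k1, hh], ?_⟩
    rw [hval _ k1 k2, AddCircle.coe_add, hh, AddCircle.coe_sub]
    abel
  have hsn : ∀ h e : ℝ, |h| < 1 / 16 → |e| ≤ η → signedNorm ((h + e : ℝ) : Circ) = h + e ∧
      |h + e| < 1 / 8 := by
    intro h e hh he
    have : |h + e| < 1 / 8 := (abs_add_le h e).trans_lt (by linarith)
    exact ⟨signedNorm_coe (by linarith), this⟩
  have hsn0 : ∀ h : ℝ, |h| < 1 / 16 → signedNorm (h : Circ) = h := fun h hh =>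
    signedNorm_coe (by linarith)
  refine ⟨n, t₀ - η, t₀ + η, y, by linarith, fun t ht => ?_, ?_, ?_, ?_, ?_⟩
  · obtain ⟨h, -, -, h1, h2, -⟩ := hI t ht
    exact ⟨h1, h2⟩
  · rintro _ ⟨t, ht, rfl⟩
    obtain ⟨h, hh, he, -, -, -, h4⟩ := hI t ht
    rw [Metric.mem_ball, dist_eq_norm, h4]
    exact (norm_coe_le_abs _).trans_lt (hsn h _ hh he).2
  · rintro _ ⟨t, ht, rfl⟩
    obtain ⟨h, hh, he, -, -, h3, -⟩ := hI t ht
    rw [Metric.mem_ball, dist_eq_norm, h3]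
    exact (norm_coe_le_abs _).trans_lt (by linarith)
  · obtain ⟨h, hh, he, -, -, h3, h4⟩ := hI (t₀ - η) ⟨le_rfl, by linarith⟩
    rw [h3, h4, (hsn h _ hh he).1, hsn0 h hh]
    linarith
  · obtain ⟨h, hh, he, -, -, h3, h4⟩ := hI (t₀ + η) ⟨by linarith, le_rfl⟩
    rw [h3, h4, (hsn h _ hh he).1, hsn0 h hh]
    linarith

/-- For transitive dynamics, crossings are created by coherent small perturbations. -/
theorem IsTransitive.exists_crosses (hT : IsTransitive R) (hR : IsSkew R α)
    (hα : DenseRange fun k : ℤ => k • α) (hV : IsCut α V) {U₁ U₂ : Set Circ} (hU₁ : IsOpen U₁)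
    (hU₂ : IsOpen U₂) (hne₁ : U₁.Nonempty) (hne₂ : U₂.Nonempty) {W : Set C(Circ, Circ)}
    (hW : W ∈ 𝓝 γ) : ∃ γ' ∈ W, Crosses R α γ' U₁ U₂ ∧ Coherent R α V γ γ' := by
  obtain ⟨r₁, s₁, J₁, hJ₁U, hJ₁o, hJ₁n, hbox₁⟩ := hV.exists_isBox_of_isOpen hα hU₁ hne₁
  obtain ⟨r₂, s₂, J₂, hJ₂U, hJ₂o, hJ₂n, hbox₂⟩ := hV.exists_isBox_of_isOpen hα hU₂ hne₂
  obtain ⟨δ₁, hδ₁, W₁, hW₁, hpert₁⟩ := hR.exists_perturb_mem_nhds r₁ s₁ hW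
  obtain ⟨δ₂, hδ₂, hpert₂⟩ := hR.exists_perturb_mem r₂ s₂ hW₁
  set δ := min δ₁ (1 / 8) with hδ
  have hδ0 : 0 < δ := by positivity
  have hopen : ∀ (J : Set Circ) (ε : ℝ), IsOpen J →
      IsOpen {z : Torus | z.1 ∈ J ∧ ‖z.2 - γ z.1‖ < ε} :=
    fun J ε hJ => (hJ.preimage continuous_fst).inter (isOpen_lt
      (continuous_snd.sub (γ.continuous.comp continuous_fst)).norm continuous_const)
  have hnon : ∀ (J : Set Circ) (ε : ℝ), J.Nonempty → 0 < ε →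
      {z : Torus | z.1 ∈ J ∧ ‖z.2 - γ z.1‖ < ε}.Nonempty := by
    rintro J ε ⟨θ, hθ⟩ hε
    exact ⟨(θ, γ θ), hθ, by simpa using hε⟩
  -- Transitivity sends a point near the graph over `J₂` to a point near the graph over `J₁`, at a
  -- time exceeding the extents of the blocks so that the two bends can be made separately.
  obtain ⟨n, hn, ⟨θ, x⟩, ⟨hθ, hx⟩, hz⟩ := hT.exists_ge (hopen J₂ δ₂ hJ₂o) (hopen J₁ δ hJ₁o)
    (hnon J₂ δ₂ hJ₂n hδ₂) (hnon J₁ δ hJ₁n hδ0) (s₂.natAbs + r₁.natAbs + 1)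
  rw [hR.zpow_apply] at hz
  obtain ⟨hθ', hx'⟩ := hz
  dsimp only at hθ hx hθ' hx'
  set N : Set Circ := J₂ ∩ {u | ∀ m ∈ Finset.Icc r₂ s₂, u ≠ θ + (n - m : ℤ) • α} with hN
  have hNθ : N ∈ 𝓝 θ := by
    refine inter_mem (hJ₂o.mem_nhds hθ) ((Filter.eventually_all_finset _).2 fun m hm => ?_)
    rw [Finset.mem_Icc] at hm
    refine isOpen_ne.mem_nhds fun h => ?_
    exact zsmul_ne_zero_of_denseRange hα (n := n - m) (by omega) (by simpa using h.symm)
  obtain ⟨φ, hφ1, hφ, hφ0⟩ := exists_bump hNθ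
  obtain ⟨e, he, hea⟩ := exists_lift_abs_eq_norm (x - γ θ)
  set τ : C(Circ, Circ) := ⟨fun u => ((φ u * e : ℝ) : Circ),
    continuous_coe.comp (φ.continuous.mul continuous_const)⟩ with hτ
  have hτ0 : ∀ u ∉ N, τ u = 0 := fun u hu => by simp [hτ, hφ0 u hu]
  have hτδ : ∀ u, ‖τ u‖ < δ₂ := by
    intro u
    refine (norm_coe_le_abs _).trans_lt (lt_of_le_of_lt ?_ hx)
    rw [abs_mul, abs_of_nonneg (hφ u).1, ← hea]
    exact mul_le_of_le_one_left (abs_nonneg _) (hφ u).2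
  have hboxN : IsBox α V N r₂ s₂ := hbox₂.mono inter_subset_left
  set γ₁ := perturb R α r₂ s₂ τ γ with hγ₁
  -- The first bend passes through `(θ, x)`, so the image of `γ₁` comes within `δ` of the unmoved
  -- point of the graph over `θ + nα`.
  have hγ₁θ : γ₁ θ = x := by
    have := hboxN.coord_perturb hR hτ0 (mem_of_mem_nhds hNθ) hbox₂.nonpos hbox₂.nonneg (γ := γ)
    rw [coord_zero, coord_zero] at this
    rw [hγ₁, this]
    change γ θ + ((φ θ * e : ℝ) : Circ) = _
    rw [hφ1.self_of_nhds, one_mul, he]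
    abel
  have hγ₁θ' : γ₁ (θ + (n : ℤ) • α) = γ (θ + (n : ℤ) • α) := by
    refine hR.perturb_apply_of_notMem hτ0 fun u hu m h1 h2 h => ?_
    exact hu.2 m (Finset.mem_Icc.2 ⟨h1, h2⟩) (eq_add_sub_zsmul h.symm)
  have hcoord : coord R α γ₁ (-n) (θ + (n : ℤ) • α) = fib R n (θ, x) := by
    rw [hR.coord_add, neg_add_cancel, coord_zero, hγ₁θ]
  obtain ⟨τ', hτ'δ, hτ'0, hcross⟩ := hbox₁.exists_crosses hR hα (γ := γ₁) (hJ₁o.mem_nhds hθ')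
    (n := n) (by omega) (min_le_right δ₁ (1 / 8)) (by rw [hcoord, hγ₁θ']; exact hx')
    (hU₁.mem_nhds (hJ₁U hθ')) (U₂ := U₂)
        (by rw [add_sub_cancel_right]; exact hU₂.mem_nhds (hJ₂U hθ))
  exact ⟨_, hpert₁ γ₁ (hpert₂ τ hτδ) τ' fun u => (hτ'δ u).trans_le (min_le_left _ _), hcross,
    (hboxN.coherent_perturb hR hτ0).trans (hbox₁.coherent_perturb hR hτ'0)⟩

end

section

variable {R : Torus ≃ₜ Torus} {α : Circ} {V : Set Circ} {γ : C(Circ, Circ)}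

/-! ### Graphs and their images -/

theorem IsSkew.mem_iter_graph (hR : IsSkew R α) (n : ℤ) (z : Torus) :
    z ∈ iter R n (graph γ) ↔ z.2 = coord R α γ (-n) z.1 := by
  obtain ⟨θ, x⟩ := z
  simp only [iter, coord, neg_neg]
  constructor
  · rintro ⟨⟨θ', x'⟩, h, h'⟩
    change x' = γ θ' at h
    rw [hR.zpow_apply, Prod.mk.injEq] at h'
    obtain ⟨rfl, rfl⟩ := h'
    rw [h, neg_zsmul, add_neg_cancel_right]
  · intro h
    refine ⟨(θ + (-n) • α, γ (θ + (-n) • α)), rfl, ?_⟩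
    rw [hR.zpow_apply, ← h, neg_zsmul, neg_add_cancel_right]

theorem IsSkew.fst_image_inter_iter (hR : IsSkew R α) (n : ℤ) :
    Prod.fst '' (graph γ ∩ iter R n (graph γ)) = coincidence R α γ 0 (-n) := by
  ext θ
  simp only [coincidence, coord_zero, mem_ofPred_eq, mem_image, mem_inter_iff, hR.mem_iter_graph]
  constructor
  · rintro ⟨⟨θ', x⟩, ⟨h1, h2⟩, rfl⟩
    exact (show x = γ θ' from h1) ▸ h2
  · exact fun h => ⟨(θ, γ θ), ⟨rfl, h⟩, rfl⟩

/-! ### Intervals -/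

/-- Otherwise each of the two arcs joining two points of `I` contains a missing point, and these two
points disconnect `I`. -/
theorem IsNontrivialInterval.exists_isOpen_subset {I : Set Circ} (hI : IsNontrivialInterval I) :
    ∃ U ⊆ I, IsOpen U ∧ U.Nonempty := by
  obtain ⟨x, hx, y, hy, hxy⟩ := hI.2
  obtain ⟨a, rfl, -⟩ := exists_lift_abs_eq_norm x
  obtain ⟨b, ⟨hab, hba⟩, rfl⟩ : ∃ b ∈ Ico a (a + 1), ((b : ℝ) : Circ) = y := by
    have : y ∈ ((↑) : ℝ → Circ) '' Ico a (a + 1) := AddCircle.coe_image_Ico_eq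
        (1 : ℝ) a ▸ mem_univ y
    exact this
  have hlt : a < b := hab.lt_of_ne fun h => hxy (h ▸ rfl)
  have ho : ∀ s t : ℝ, IsOpen (((↑) : ℝ → Circ) '' Ioo s t) := fun s t => isOpenMap_coe _ isOpen_Ioo
  by_contra! hcon
  have hp : ∃ p ∈ Ioo a b, (p : Circ) ∉ I := by
    by_contra! h
    exact ((nonempty_Ioo.2 hlt).image _).ne_empty (hcon _ (image_subset_iff.2 h) (ho _ _))
  have hq : ∃ q ∈ Ioo b (a + 1), (q : Circ) ∉ I := by
    by_contra! h
    exact ((nonempty_Ioo.2 hba).image _).ne_empty (hcon _ (image_subset_iff.2 h) (ho _ _))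
  obtain ⟨p, ⟨hap, hpb⟩, hp⟩ := hp
  obtain ⟨q, ⟨hbq, hqa⟩, hq⟩ := hq
  have hcov : I ⊆ ((↑) : ℝ → Circ) '' Ioo p q ∪ ((↑) : ℝ → Circ) '' Ioo q (p + 1) := by
    intro z hz
    obtain ⟨t, ⟨h1, h2⟩, rfl⟩ : ∃ t ∈ Ico p (p + 1), ((t : ℝ) : Circ) = z := by
      have : z ∈ ((↑) : ℝ → Circ) '' Ico p (p + 1) := AddCircle.coe_image_Ico_eq
          (1 : ℝ) p ▸ mem_univ z
      exact this
    have h3 : p < t := h1.lt_of_ne fun h => hp (h ▸ hz)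
    rcases lt_trichotomy t q with h | h | h
    · exact .inl ⟨t, ⟨h3, h⟩, rfl⟩
    · exact absurd (h ▸ hz) hq
    · exact .inr ⟨t, ⟨h, h2⟩, rfl⟩
  obtain ⟨z, -, ⟨s, ⟨hs1, hs2⟩, rfl⟩, ⟨t, ⟨ht1, ht2⟩, hst⟩⟩ := hI.1.isPreconnected _ _ (ho p q)
      (ho q (p + 1)) hcov
    ⟨b, hy, b, ⟨hpb, hbq⟩, rfl⟩ ⟨a, hx, a + 1, ⟨hqa, by linarith⟩, by simp⟩
  refine coe_ne_zero_of_abs_lt_one (t := t - s) (by linarith) ?_ ?_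
  · rw [abs_lt]
    constructor <;> linarith
  · rw [AddCircle.coe_sub, hst, sub_self]

/-! ### Crossings of graphs -/

theorem isConnected_ball (c : Circ) {ε : ℝ} (hε : 0 < ε) : IsConnected (Metric.ball c ε) := by
  obtain ⟨t, rfl, -⟩ := exists_lift_abs_eq_norm c
  have : Metric.ball (t : Circ) ε = ((↑) : ℝ → Circ) '' Metric.ball t ε := by
    ext x
    constructor
    · intro h
      obtain ⟨s, hs, hsn⟩ := exists_lift_abs_eq_norm (x - t)
      rw [Metric.mem_ball, dist_eq_norm, ← hsn] at h
      refine ⟨t + s, ?_, by rw [AddCircle.coe_add, hs, add_sub_cancel]⟩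
      rwa [Metric.mem_ball, Real.dist_eq, add_sub_cancel_left]
    · rintro ⟨s, hs, rfl⟩
      rw [Metric.mem_ball, dist_eq_norm, ← AddCircle.coe_sub]
      exact (norm_coe_le_abs _).trans_lt hs
  rw [this]
  exact (Metric.isConnected_ball hε).image _ continuous_coe.continuousOn

/-- The part of a thin strip strictly between a graph and a boundary component, described by the
sign `σ` of that component, is preconnected. -/
theorem exists_isPreconnected_strip {a b : ℝ} {c : Circ} {f : Circ → Circ} (hf : Continuous f)
    (hfb : ∀ x ∈ ((↑) : ℝ → Circ) '' Icc a b, f x ∈ Metric.ball c (1 / 8)) (σ : ℝ)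
    (hσ : σ = 1 ∨ σ = -1) :
    IsPreconnected {z : Torus | z.1 ∈ ((↑) : ℝ → Circ) '' Icc a b ∧ z.2 ∈ Metric.ball c (1 / 8) ∧
      σ * signedNorm (f z.1 - c) < σ * signedNorm (z.2 - c)} := by
  set u : ℝ → ℝ := fun t => signedNorm (f t - c) with hu
  have huc : Continuous u :=
    continuous_signedNorm.comp ((hf.comp continuous_coe).sub continuous_const)
  have hu8 : ∀ t ∈ Icc a b, |u t| < 1 / 8 := fun t ht =>
    (abs_signedNorm_le _).trans_lt (by simpa [dist_eq_norm] using hfb t ⟨t, ht, rfl⟩)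
  have hσ2 : σ * σ = 1 := by rcases hσ with rfl | rfl <;> norm_num
  have hσa : ∀ w : ℝ, |σ * w| = |w| := by rcases hσ with rfl | rfl <;> simp
  -- On each fibre, the parameter in `(0, 1)` interpolates between the graph and the boundary level
  -- `σ / 8`, exhibiting the strip as the image of a rectangle.
  let F : ℝ × ℝ → Torus := fun w =>
    (w.1, c + (((1 - w.2) * u w.1 + w.2 * (σ / 8) : ℝ) : Circ))
  have hF : Continuous F := (continuous_coe.comp continuous_fst).prodMk
    (continuous_const.add (continuous_coe.comp (by fun_prop)))
  have himg : {z : Torus | z.1 ∈ ((↑) : ℝ → Circ) '' Icc a b ∧ z.2 ∈ Metric.ball c (1 / 8) ∧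
      σ * signedNorm (f z.1 - c) < σ * signedNorm (z.2 - c)} = F '' (Icc a b ×ˢ Ioo 0 1) := by
    ext ⟨x, y⟩
    constructor
    · rintro ⟨⟨t, ht, rfl⟩, hy, hlt⟩
      change σ * u t < σ * signedNorm (y - c) at hlt
      dsimp only at hy
      rw [Metric.mem_ball, dist_eq_norm] at hy
      set h := signedNorm (y - c) with hh
      have h8 : |σ * h| < 1 / 8 := by
        rw [hσa]
        exact (abs_signedNorm_le _).trans_lt hy
      have hu' : |σ * u t| < 1 / 8 := by
        rw [hσa]
        exact hu8 t ht
      rw [abs_lt] at h8 hu'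
      have hd : 0 < 1 / 8 - σ * u t := by linarith
      obtain ⟨l, hl⟩ : ∃ l, l = (σ * h - σ * u t) / (1 / 8 - σ * u t) := ⟨_, rfl⟩
      refine ⟨(t, l), ⟨ht, hl ▸ div_pos (by linarith) hd,
        hl ▸ (div_lt_one hd).2 (by linarith)⟩, ?_⟩
      rw [eq_div_iff hd.ne'] at hl
      have hval : (1 - l) * u t + l * (σ / 8) = h := by
        linear_combination σ * hl + (l * u t - u t + h) * hσ2
      refine Prod.ext rfl ?_
      change c + ((_ : ℝ) : Circ) = y
      rw [hval, hh, coe_signedNorm (by linarith), add_sub_cancel]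
    · rintro ⟨⟨t, l⟩, ⟨ht, hl0, hl1⟩, he⟩
      obtain ⟨rfl, rfl⟩ := Prod.mk.inj he
      dsimp only at ht hl0 hl1
      have hu' : |σ * u t| < 1 / 8 := by
        rw [hσa]
        exact hu8 t ht
      rw [abs_lt] at hu'
      have hb : |(1 - l) * u t + l * (σ / 8)| < 1 / 8 := by
        rw [← hσa, show σ * ((1 - l) * u t + l * (σ / 8)) = (1 - l) * (σ * u t) + l / 8 by
          linear_combination (l / 8) * hσ2, abs_lt]
        constructor <;> nlinarith
      refine ⟨⟨t, ht, rfl⟩, ?_, ?_⟩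
      · dsimp only
        rw [Metric.mem_ball, dist_eq_norm, add_sub_cancel_left]
        exact (norm_coe_le_abs _).trans_lt hb
      · dsimp only
        rw [add_sub_cancel_left, signedNorm_coe (by linarith)]
        change σ * u t < _
        nlinarith
  rw [himg]
  exact (isPreconnected_Icc.prod isPreconnected_Ioo).image _ hF.continuousOn

/-- The complement of the graph in the strip consists of two connected sides, `σ = 1` and `σ = -1`.
The second graph meets the former over `a` and the latter over `b`. -/
theorem crossOver_of_signedNorm_lt {a b : ℝ} (hab : a ≤ b) {c : Circ} {f f' : Circ → Circ}
    (hf : Continuous f) (hfb : ∀ x ∈ ((↑) : ℝ → Circ) '' Icc a b, f x ∈ Metric.ball c (1 / 8))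
    (hfb' : ∀ x ∈ ((↑) : ℝ → Circ) '' Icc a b, f' x ∈ Metric.ball c (1 / 8))
    (ha : signedNorm (f a - c) < signedNorm (f' a - c))
    (hb : signedNorm (f' b - c) < signedNorm (f b - c)) {A : Set Circ}
    (hA : ((↑) : ℝ → Circ) '' Icc a b ⊆ A) : CrossOver (graph f) (graph f') A := by
  have hsub : ∀ g : Circ → Circ, (∀ x ∈ ((↑) : ℝ → Circ) '' Icc a b, g x ∈ Metric.ball c (1 / 8)) →
      above (graph g) (((↑) : ℝ → Circ) '' Icc a b) ⊆
        (((↑) : ℝ → Circ) '' Icc a b) ×ˢ Metric.ball c (1 / 8) := by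
    rintro g hg ⟨x, y⟩ ⟨h, hx, -⟩
    exact ⟨hx, (show y = g x from h) ▸ hg x hx⟩
  refine ⟨((↑) : ℝ → Circ) '' Icc a b, Metric.ball c (1 / 8), hA,
    (isConnected_Icc hab).image _ continuous_coe.continuousOn, Metric.isOpen_ball,
    isConnected_ball c (by norm_num), fun h => ?_, hsub f hfb, hsub f' hfb', ?_⟩
  · have : c + ((1 / 4 : ℝ) : Circ) ∈ Metric.ball c (1 / 8) := h ▸ mem_univ _
    rw [Metric.mem_ball, dist_eq_norm, add_sub_cancel_left,
        norm_coe_eq_abs (by norm_num [abs_of_pos])] at this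
    norm_num [abs_of_pos] at this
  have key : ∀ σ : ℝ, σ = 1 ∨ σ = -1 → ∀ t ∈ Icc a b,
      σ * signedNorm (f t - c) < σ * signedNorm (f' t - c) → ∀ x y : Circ,
      x ∈ ((↑) : ℝ → Circ) '' Icc a b → y ∈ Metric.ball c (1 / 8) →
      σ * signedNorm (f x - c) < σ * signedNorm (y - c) →
      (above (graph f') (((↑) : ℝ → Circ) '' Icc a b) ∩ connectedComponentIn
        ((((↑) : ℝ → Circ) '' Icc a b) ×ˢ Metric.ball c (1 / 8) \ graph f) (x, y)).Nonempty := by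
    intro σ hσ t ht htlt x y hx hy hlt
    have htm : (t : Circ) ∈ ((↑) : ℝ → Circ) '' Icc a b := ⟨t, ht, rfl⟩
    refine ⟨(t, f' t), ⟨rfl, htm, mem_univ _⟩,
      (exists_isPreconnected_strip hf hfb σ hσ).subset_connectedComponentIn
        (x := (x, y)) ⟨hx, hy, hlt⟩ ?_ ⟨htm, hfb' _ htm, htlt⟩⟩
    rintro ⟨x', y'⟩ ⟨h1, h2, h3⟩
    refine ⟨⟨h1, h2⟩, fun h => ?_⟩
    rw [show y' = f x' from h] at h3
    exact h3.false
  rintro ⟨x, y⟩ ⟨⟨hx, hy⟩, hxy⟩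
  have hne : signedNorm (f x - c) ≠ signedNorm (y - c) := by
    intro h
    have h1 := hfb x hx
    have h2 := hy
    rw [Metric.mem_ball, dist_eq_norm] at h1 h2
    have h3 := congrArg (fun t : ℝ => (t : Circ)) h
    dsimp only at h3 h2
    rw [coe_signedNorm (by linarith), coe_signedNorm (by linarith)] at h3
    exact hxy (sub_left_injective h3).symm
  rcases hne.lt_or_gt with h | h
  · exact key 1 (.inl rfl) a ⟨le_rfl, hab⟩ (by linarith) x y hx hy (by linarith)
  · exact key (-1) (.inr rfl) b ⟨hab, le_rfl⟩ (by linarith) x y hx hy (by linarith)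

theorem Crosses.crossOver (hR : IsSkew R α) {U₁ U₂ : Set Circ} (h : Crosses R α γ U₁ U₂) :
    ∃ n : ℕ, CrossOver (graph γ) (iter R n (graph γ)) (U₁ ∩ (· + (n : ℤ) • α) '' U₂) := by
  obtain ⟨n, a, b, c, hab, hU, h1, h2, h3, h4⟩ := h
  refine ⟨n, ?_⟩
  have : iter R n (graph γ) = graph (coord R α γ (-n)) := by
    ext z
    exact hR.mem_iter_graph n z
  rw [this]
  refine crossOver_of_signedNorm_lt hab γ.continuous h1 h2 h3 h4 ?_
  rintro _ ⟨t, ht, rfl⟩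
  exact ⟨(hU t ht).1, _, (hU t ht).2, sub_add_cancel _ _⟩

theorem CrossOver.mono {Γ Γ' : Set Torus} {A B : Set Circ} (h : CrossOver Γ Γ' A) (hAB : A ⊆ B) :
    CrossOver Γ Γ' B := by
  obtain ⟨I, O, hI, h⟩ := h
  exact ⟨I, O, hI.trans hAB, h⟩

/-! ### The main theorem -/

theorem IsSkew.flatIntersections (hR : IsSkew R α)
    (h : ∀ n θ, FlatAt (coincidence R α γ 0 n) θ) (n : ℤ) :
    FlatIntersections (graph γ) (iter R n (graph γ)) := by
  rw [FlatIntersections, hR.fst_image_inter_iter]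
  exact exists_intervals_of_flatAt (isClosed_coincidence γ 0 (-n)) (h (-n))

theorem IsSkew.exists_flat_graph (hR : IsSkew R α) (hα : DenseRange fun k : ℤ => k • α) :
    ∃ γ : C(Circ, Circ), ∀ n : ℤ, FlatIntersections (graph γ) (iter R n (graph γ)) := by
  obtain ⟨γ, hγ, -⟩ := exists_limit_graph hR hα (X := fun _ => univ) (fun _ => isOpen_univ)
    fun k V γ _ W hW => ⟨γ, mem_of_mem_nhds hW, mem_univ _, .refl γ⟩
  exact ⟨γ, hR.flatIntersections hγ⟩

/-- Every non-trivial interval contains a basic open set, so it suffices to impose a crossing for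
each of the countably many pairs of basic sets. -/
theorem IsTransitive.exists_flat_crossing_graph (hT : IsTransitive R) (hR : IsSkew R α)
    (hα : DenseRange fun k : ℤ => k • α) :
    ∃ γ : C(Circ, Circ), (∀ n : ℤ, FlatIntersections (graph γ) (iter R n (graph γ))) ∧
      ∀ I J : Set Circ, IsNontrivialInterval I → IsNontrivialInterval J →
        ∃ n : ℕ, CrossOver (graph γ) (iter R n (graph γ)) (I ∩ (· + (n : ℤ) • α) '' J) := by
  have hB := TopologicalSpace.isBasis_countableBasis Circ
  obtain ⟨f, hf⟩ := (TopologicalSpace.countable_countableBasis Circ).exists_eq_range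
    ((hB.exists_subset_of_mem_open (mem_univ 0) isOpen_univ).imp fun _ h => h.1)
  have hfo : ∀ k, IsOpen (f k) ∧ (f k).Nonempty := fun k => by
    have : f k ∈ TopologicalSpace.countableBasis Circ := hf ▸ mem_range_self k
    exact ⟨hB.isOpen this, TopologicalSpace.nonempty_of_mem_countableBasis this⟩
  obtain ⟨γ, hγ, hX⟩ := exists_limit_graph hR hα
    (X := fun k => {γ | Crosses R α γ (f k.unpair.1) (f k.unpair.2)})
    (fun k => isOpen_setOf_crosses _ _) fun k V γ hV W hW => hT.exists_crosses hR hα hV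
      (hfo _).1 (hfo _).1 (hfo _).2 (hfo _).2 hW
  have hsub : ∀ I : Set Circ, IsNontrivialInterval I → ∃ k, f k ⊆ I := by
    intro I hI
    obtain ⟨U, hU, hUo, x, hx⟩ := hI.exists_isOpen_subset
    obtain ⟨v, hv, -, hvU⟩ := hB.exists_subset_of_mem_open hx hUo
    obtain ⟨k, rfl⟩ := hf ▸ hv
    exact ⟨k, hvU.trans hU⟩
  refine ⟨γ, hR.flatIntersections hγ, fun I J hI hJ => ?_⟩
  obtain ⟨i, hi⟩ := hsub I hI
  obtain ⟨j, hj⟩ := hsub J hJ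
  have := hX (Nat.pair i j)
  simp only [mem_ofPred_eq, Nat.unpair_pair] at this
  obtain ⟨n, hn⟩ := this.crossOver hR
  exact ⟨n, hn.mono (inter_subset_inter hi (image_mono hj))⟩

end

end QPF

theorem mainTheorem3 (ω : ℝ) (R : QPF.Torus ≃ₜ QPF.Torus) (hR : QPF.IsQPFHomeo ω R)
    (hgraph : ¬ ∃ (p q : ℕ) (K : Set QPF.Torus), QPF.IsContinuousInvariantGraph R p q K) :
    (∃ γ : QPF.Circ → QPF.Circ, Continuous γ ∧
      ∀ n : ℤ, QPF.FlatIntersections (QPF.graph γ) (QPF.iter R n (QPF.graph γ))) ∧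
    (QPF.IsTransitive R →
      ∃ γ : QPF.Circ → QPF.Circ, Continuous γ ∧
        (∀ n : ℤ, QPF.FlatIntersections (QPF.graph γ) (QPF.iter R n (QPF.graph γ))) ∧
        ∀ I J : Set QPF.Circ, QPF.IsNontrivialInterval I → QPF.IsNontrivialInterval J →
          ∃ n : ℕ, QPF.CrossOver (QPF.graph γ) (QPF.iter R n (QPF.graph γ))
            (I ∩ QPF.translate ω n J)) := by
  have hs : QPF.IsSkew R (ω : QPF.Circ) := hR.skew
  have hα : DenseRange fun k : ℤ => k • (ω : QPF.Circ) :=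
    AddCircle.denseRange_zsmul_coe_iff.2 (by simpa using hR.irrational)
  constructor
  · obtain ⟨γ, hγ⟩ := hs.exists_flat_graph hα
    exact ⟨γ, γ.continuous, hγ⟩
  · intro hT
    obtain ⟨γ, hγ, hc⟩ := hT.exists_flat_crossing_graph hs hα
    exact ⟨γ, γ.continuous, hγ, hc⟩
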